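/- Let $k$ be an algebraically closed field, let $t,n$ be integers with $4\le 2t\le n$, and put $V=k^n$, $E=k^{2t-2}$. Let $\langle\ ,\ \rangle$ be the alternating bilinear form on $E$ whose Gram matrix in the standard basis is $\tilde J=\begin{pmatrix}0&J\\-J&0\end{pmatrix}$, where $J$ is the $(t-1)\times(t-1)$ matrix with ones on the antidiagonal and zeros elsewhere. Let $G=\{g : {}^tg\tilde Jg=\tilde J\}$ be the symplectic group scheme of $E$, acting on the affine space $M=\operatorname{Hom}(V,E)$ by $(g,\varphi)\mapsto g\varphi$. For $s\ge 1$ let $Y_s$ be the closed subscheme of the affine space of alternating $n\times n$ matrices defined by the vanishing of the Pfaffians of all main $2s\times 2s$ submatrices (same row and column indices $i_1<\dots<i_{2s}$). Let $\pi\colon M\to Y_t$ be the $k$-morphism $X\mapsto {}^tX\tilde JX$, where $X$ is the matrix of $\varphi\in M$ (that is, $\varphi\in M$ is sent to the pulled back form $\langle\varphi\,\cdot,\varphi\,\cdot\rangle$), and let $U=Y_t\setminus Y_{t-1}$, an open subscheme of $Y_t$. Then the underlying set of $U$ is the locus of alternating matrices of rank exactly $2(t-1)$ (the rank at a point being taken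 over its residue field), and the restriction $\pi|_{\pi^{-1}(U)}\colon \pi^{-1}(U)\to U$ is a principal $G$-bundle, i.e. 1. it is faithfully flat (flat and surjective); 2. it is $G$-invariant: $\pi(gx)=\pi(x)$, as an equality of morphisms $G\times\pi^{-1}(U)\to U$, where $G$ acts on $\pi^{-1}(U)$ by restriction of its action on $M$; 3. the morphism $\Phi\colon G\times\pi^{-1}(U)\to\pi^{-1}(U)\times_U\pi^{-1}(U)$, $\Phi(g,x)=(gx,x)$, is an isomorphism of schemes. -/

import Mathlib

open Matrix
noncomputable section
namespace SymplecticInvariants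
universe u

/-- The odd positions `1, 3, …, 2m-1`, which are `0, 2, …, 2m-2` when counted from `0`. -/
def evenIdx {m : ℕ} (i : Fin m) : Fin (2 * m) := ⟨2 * i, by omega⟩
/-- The even positions `2, 4, …, 2m`, which are `1, 3, …, 2m-1` when counted from `0`. -/
def oddIdx {m : ℕ} (i : Fin m) : Fin (2 * m) := ⟨2 * i + 1, by omega⟩

/-- The permutations `σ` of `2m` letters with `σ 1 < σ 3 < ⋯` and `σ (2i-1) < σ (2i)` for all `i`
(the letters are numbered from `0` here). -/
def IsPfaffianPerm {m : ℕ} (σ : Equiv.Perm (Fin (2 * m))) : Prop :=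
  StrictMono (fun i : Fin m => σ (evenIdx i)) ∧ ∀ i : Fin m, σ (evenIdx i) < σ (oddIdx i)

open Classical in
/-- The Pfaffian of a `2m × 2m` matrix. -/
def pfaffian {R : Type*} [CommRing R] {m : ℕ}
    (A : Matrix (Fin (2 * m)) (Fin (2 * m)) R) : R :=
  ∑ σ : Equiv.Perm (Fin (2 * m)) with IsPfaffianPerm σ,
    ((Equiv.Perm.sign σ : ℤ) : R) * ∏ i : Fin m, A (σ (evenIdx i)) (σ (oddIdx i))

theorem map_pfaffian {R S : Type*} [CommRing R] [CommRing S] (f : R →+* S) {m : ℕ}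
    (A : Matrix (Fin (2 * m)) (Fin (2 * m)) R) : f (pfaffian A) = pfaffian (A.map f) := by
  simp [pfaffian, map_sum, map_prod]

/-- Positions, as a pair number together with a place in the pair. -/
def pairIdx (m : ℕ) : Fin m × Bool ≃ Fin (2 * m) where
  toFun p := bif p.2 then oddIdx p.1 else evenIdx p.1
  invFun j := (⟨j / 2, by omega⟩, decide (j.1 % 2 = 1))
  left_inv := by
    rintro ⟨i, b⟩
    cases b
    · simp [evenIdx]
    · simp [oddIdx, Fin.ext_iff]
      omega
  right_inv j := by
    rcases Nat.mod_two_eq_zero_or_one j.1 with h | h <;>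
      simp [oddIdx, evenIdx, Fin.ext_iff, h] <;> omega

@[simp] theorem pairIdx_true {m : ℕ} (i : Fin m) : pairIdx m (i, true) = oddIdx i := rfl
@[simp] theorem pairIdx_false {m : ℕ} (i : Fin m) : pairIdx m (i, false) = evenIdx i := rfl

/-- Permuting the pairs by `τ` and flipping the pairs marked by `ε`. -/
def pairPerm {m : ℕ} (τ : Equiv.Perm (Fin m)) (ε : Fin m → Bool) : Equiv.Perm (Fin (2 * m)) :=
  (pairIdx m).permCongr
    ((Equiv.prodCongrRight fun i => if ε i then Equiv.boolNot else 1).trans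
      (τ.prodCongr (Equiv.refl Bool)))

theorem pairPerm_even {m : ℕ} (τ : Equiv.Perm (Fin m)) (ε : Fin m → Bool) (i : Fin m) :
    pairPerm τ ε (evenIdx i) = pairIdx m (τ i, ε i) := by
  rw [← pairIdx_false]
  simp only [pairPerm, Equiv.permCongr_apply, Equiv.symm_apply_apply]
  cases h : ε i <;> simp [h]

theorem pairPerm_odd {m : ℕ} (τ : Equiv.Perm (Fin m)) (ε : Fin m → Bool) (i : Fin m) :
    pairPerm τ ε (oddIdx i) = pairIdx m (τ i, !ε i) := by
  rw [← pairIdx_true]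
  simp only [pairPerm, Equiv.permCongr_apply, Equiv.symm_apply_apply]
  cases h : ε i <;> simp [h]

theorem sign_pairPerm {m : ℕ} (τ : Equiv.Perm (Fin m)) (ε : Fin m → Bool) :
    Equiv.Perm.sign (pairPerm τ ε) = ∏ i, (if ε i then -1 else 1) := by
  rw [pairPerm, Equiv.Perm.sign_permCongr]
  rw [← Equiv.Perm.mul_def, Equiv.Perm.sign_mul]
  have h1 : Equiv.Perm.sign (τ.prodCongr (Equiv.refl Bool)) = 1 := by
    have : τ.prodCongr (Equiv.refl Bool) = Equiv.prodCongrLeft (fun _ : Bool => τ) := by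
      ext ⟨_, _⟩ <;> simp
    rw [this, Equiv.Perm.sign_prodCongrLeft]
    simp
  rw [h1, one_mul, Equiv.Perm.sign_prodCongrRight]
  refine Finset.prod_congr rfl fun i _ => ?_
  split_ifs
  · decide
  · simp


theorem existsUnique_pairPerm {m : ℕ} (σ : Equiv.Perm (Fin (2 * m))) :
    ∃! p : Equiv.Perm (Fin m) × (Fin m → Bool), IsPfaffianPerm (σ * pairPerm p.1 p.2) := by
  classical
  let s : Fin m → Bool := fun i => decide (σ (oddIdx i) < σ (evenIdx i))
  let f : Fin m → Fin (2 * m) := fun i => σ (pairIdx m (i, s i))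
  have hf : Function.Injective f := fun i j h => by
    have := (pairIdx m).injective (σ.injective h)
    exact congrArg Prod.fst this
  have hne : ∀ i : Fin m, σ (evenIdx i) ≠ σ (oddIdx i) := fun i h => by
    have := σ.injective h
    simp [evenIdx, oddIdx] at this
  have key : ∀ (τ : Equiv.Perm (Fin m)) (ε : Fin m → Bool),
      IsPfaffianPerm (σ * pairPerm τ ε) ↔ StrictMono (f ∘ τ) ∧ ε = s ∘ τ := by
    intro τ ε
    have h2 : (∀ i : Fin m, (σ * pairPerm τ ε) (evenIdx i) < (σ * pairPerm τ ε) (oddIdx i)) ↔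
        ε = s ∘ τ := by
      rw [funext_iff]
      refine forall_congr' fun i => ?_
      simp only [Equiv.Perm.mul_apply, pairPerm_even, pairPerm_odd, Function.comp_apply, s]
      have := hne (τ i)
      cases ε i
      · simp only [pairIdx_false, Bool.not_false, pairIdx_true]
        constructor
        · intro h; simpa using h.le
        · intro h; exact lt_of_le_of_ne (by simpa using h.symm) this
      · simp only [pairIdx_true, Bool.not_true, pairIdx_false]
        constructor
        · intro h; simpa using h
        · intro h; simpa using h.symm
    rw [IsPfaffianPerm, h2]
    refine and_congr_left fun h => ?_
    subst h
    have : (fun i => (σ * pairPerm τ (s ∘ τ)) (evenIdx i)) = f ∘ τ := by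
      funext i
      simp [pairPerm_even, f]
    rw [this]
  refine ⟨(Tuple.sort f, s ∘ Tuple.sort f), ?_, ?_⟩
  · exact (key _ _).2 ⟨(Tuple.monotone_sort f).strictMono_of_injective
      (hf.comp (Tuple.sort f).injective), rfl⟩
  · rintro ⟨τ, ε⟩ h
    obtain ⟨h1, h2⟩ := (key _ _).1 h
    have : τ = Tuple.sort f := by
      have := Tuple.unique_monotone h1.monotone (Tuple.monotone_sort f)
      ext i
      exact congrArg Fin.val (hf (congrFun this i))
    subst this
    simp at h2
    simp [h2]

/-- The summand of the Pfaffian. -/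
def pfaffianTerm {R : Type*} [CommRing R] {m : ℕ} (A : Matrix (Fin (2 * m)) (Fin (2 * m)) R)
    (σ : Equiv.Perm (Fin (2 * m))) : R :=
  ((Equiv.Perm.sign σ : ℤ) : R) * ∏ i : Fin m, A (σ (evenIdx i)) (σ (oddIdx i))

theorem pfaffianTerm_mul {R : Type*} [CommRing R] {m : ℕ}
    (A : Matrix (Fin (2 * m)) (Fin (2 * m)) R) (hA : ∀ i j, A i j = -A j i)
    (σ : Equiv.Perm (Fin (2 * m))) (τ : Equiv.Perm (Fin m)) (ε : Fin m → Bool) :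
    pfaffianTerm A (σ * pairPerm τ ε) = pfaffianTerm A σ := by
  have h : ∀ i : Fin m, A ((σ * pairPerm τ ε) (evenIdx i)) ((σ * pairPerm τ ε) (oddIdx i)) =
      (if ε i then -1 else 1) * A (σ (evenIdx (τ i))) (σ (oddIdx (τ i))) := by
    intro i
    simp only [Equiv.Perm.mul_apply, pairPerm_even, pairPerm_odd]
    cases ε i
    · simp
    · simp [hA (σ (oddIdx (τ i)))]
  have h3 : (∏ i, (if ε i then (-1 : R) else 1)) * ∏ i, (if ε i then (-1 : R) else 1) = 1 := by
    rw [← Finset.prod_mul_distrib]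
    refine Finset.prod_eq_one fun i _ => ?_
    split_ifs <;> simp
  have h4 : (((∏ i, (if ε i then (-1 : ℤˣ) else 1) : ℤˣ) : ℤ) : R) =
      ∏ i, (if ε i then (-1 : R) else 1) := by
    rw [Units.coe_prod, Int.cast_prod]
    refine Finset.prod_congr rfl fun i _ => ?_
    split_ifs <;> simp
  have h5 : ∏ i, A (σ (evenIdx (τ i))) (σ (oddIdx (τ i))) =
      ∏ i, A (σ (evenIdx i)) (σ (oddIdx i)) :=
    Equiv.prod_comp τ fun i => A (σ (evenIdx i)) (σ (oddIdx i))
  simp only [pfaffianTerm, h, Finset.prod_mul_distrib, Equiv.Perm.sign_mul, sign_pairPerm,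
    Units.val_mul, Int.cast_mul, h4, h5]
  linear_combination (((Equiv.Perm.sign σ : ℤ) : R) * ∏ i, A (σ (evenIdx i)) (σ (oddIdx i))) * h3

theorem sum_pfaffianTerm {R : Type*} [CommRing R] {m : ℕ}
    (A : Matrix (Fin (2 * m)) (Fin (2 * m)) R) (hA : ∀ i j, A i j = -A j i) :
    ∑ σ, pfaffianTerm A σ =
      (Fintype.card (Equiv.Perm (Fin m) × (Fin m → Bool)) : R) * pfaffian A := by
  classical
  have h1 : ∀ σ, pfaffianTerm A σ = ∑ p : Equiv.Perm (Fin m) × (Fin m → Bool),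
      if IsPfaffianPerm (σ * pairPerm p.1 p.2) then pfaffianTerm A (σ * pairPerm p.1 p.2)
      else 0 := by
    intro σ
    obtain ⟨p, hp, hu⟩ := existsUnique_pairPerm σ
    rw [Finset.sum_eq_single p, if_pos hp, pfaffianTerm_mul A hA]
    · intro q _ hq
      exact if_neg fun h => hq (hu q h)
    · simp
  have h2 : ∀ p : Equiv.Perm (Fin m) × (Fin m → Bool),
      (∑ σ, if IsPfaffianPerm (σ * pairPerm p.1 p.2) then pfaffianTerm A (σ * pairPerm p.1 p.2)
      else 0) = pfaffian A := by
    intro p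
    refine (Equiv.sum_comp (Equiv.mulRight (pairPerm p.1 p.2))
      (fun σ => if IsPfaffianPerm σ then pfaffianTerm A σ else 0)).trans ?_
    rw [← Finset.sum_filter]
    simp [pfaffian, pfaffianTerm]
  rw [Finset.sum_congr rfl fun σ _ => h1 σ, Finset.sum_comm, Finset.sum_congr rfl fun p _ => h2 p]
  simp

theorem sum_pfaffianTerm_conj {R ι : Type*} [CommRing R] [Fintype ι] [DecidableEq ι] {m : ℕ}
    (hm : Fintype.card ι < 2 * m) (J : Matrix ι ι R) (X : Matrix ι (Fin (2 * m)) R) :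
    ∑ σ, pfaffianTerm (Xᵀ * J * X) σ = 0 := by
  have h1 : ∀ σ : Equiv.Perm (Fin (2 * m)), pfaffianTerm (Xᵀ * J * X) σ =
      ∑ g : Fin m → ι × ι, (∏ i, J (g i).1 (g i).2) * (((Equiv.Perm.sign σ : ℤ) : R) *
        ∏ a, X (bif ((pairIdx m).symm a).2 then (g ((pairIdx m).symm a).1).2
          else (g ((pairIdx m).symm a).1).1) (σ a)) := by
    intro σ
    have e : ∀ a b, (Xᵀ * J * X) a b = ∑ p : ι × ι, J p.1 p.2 * (X p.1 a * X p.2 b) := by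
      intro a b
      simp only [Matrix.mul_apply, Finset.sum_mul, Matrix.transpose_apply, Fintype.sum_prod_type]
      rw [Finset.sum_comm]
      refine Finset.sum_congr rfl fun p _ => Finset.sum_congr rfl fun q _ => by ring
    simp only [pfaffianTerm, e]
    rw [Fintype.prod_sum, Finset.mul_sum]
    refine Finset.sum_congr rfl fun g _ => ?_
    rw [← Equiv.prod_comp (pairIdx m), Fintype.prod_prod_type]
    simp only [Fintype.prod_bool, Equiv.symm_apply_apply, pairIdx_true, pairIdx_false, cond_true,
      cond_false, Finset.prod_mul_distrib]
    ring
  rw [Finset.sum_congr rfl fun σ _ => h1 σ, Finset.sum_comm]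
  refine Finset.sum_eq_zero fun g _ => ?_
  rw [← Finset.mul_sum]
  set f : Fin (2 * m) → ι := fun a => bif ((pairIdx m).symm a).2 then
    (g ((pairIdx m).symm a).1).2 else (g ((pairIdx m).symm a).1).1 with hf
  have h2 : ∑ σ : Equiv.Perm (Fin (2 * m)), ((Equiv.Perm.sign σ : ℤ) : R) * ∏ a, X (f a) (σ a) =
      (X.submatrix f id)ᵀ.det := by
    rw [Matrix.det_apply']
    rfl
  obtain ⟨a, b, hab, he⟩ := Fintype.exists_ne_map_eq_of_card_lt f (by simpa using hm)
  rw [h2, Matrix.det_transpose, Matrix.det_zero_of_row_eq hab, mul_zero]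
  funext c
  simp [he]

/-- A form of rank less than `2m` has vanishing Pfaffians of size `2m`. -/
theorem pfaffian_conj_eq_zero {R ι : Type*} [CommRing R] [Fintype ι] [DecidableEq ι] {m : ℕ}
    (hm : Fintype.card ι < 2 * m) (J : Matrix ι ι ℤ) (hJ : ∀ i j, J i j = -J j i)
    (X : Matrix ι (Fin (2 * m)) R) :
    pfaffian (Xᵀ * J.map (Int.cast : ℤ → R) * X) = 0 := by
  let S := MvPolynomial (ι × Fin (2 * m)) ℤ
  let Y : Matrix ι (Fin (2 * m)) S := fun i j => MvPolynomial.X (i, j)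
  have h0 : pfaffian (Yᵀ * J.map (Int.cast : ℤ → S) * Y) = 0 := by
    have hJ' : (J.map (Int.cast : ℤ → S))ᵀ = -J.map (Int.cast : ℤ → S) := by
      ext1 i j
      simp [hJ j i]
    have := sum_pfaffianTerm (Yᵀ * J.map (Int.cast : ℤ → S) * Y) (by
      intro i j
      rw [← Matrix.transpose_apply (Yᵀ * J.map (Int.cast : ℤ → S) * Y) i j,
        Matrix.transpose_mul, Matrix.transpose_mul, hJ', Matrix.transpose_transpose,
        Matrix.neg_mul, Matrix.mul_neg, Matrix.mul_assoc, Matrix.neg_apply, neg_neg])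
    rw [sum_pfaffianTerm_conj hm, eq_comm, mul_eq_zero] at this
    refine this.resolve_left ?_
    exact Nat.cast_ne_zero.2 Fintype.card_ne_zero
  let φ : S →+* R := MvPolynomial.eval₂Hom (Int.castRingHom R) fun p => X p.1 p.2
  have hY : Y.map φ = X := by
    ext i j
    exact MvPolynomial.eval₂_X _ _ _
  have hJ2 : (J.map (Int.cast : ℤ → S)).map φ = J.map (Int.cast : ℤ → R) := by
    ext i j
    simp
  have := congrArg φ h0
  rwa [map_pfaffian, Matrix.map_mul, Matrix.map_mul, Matrix.transpose_map, hY, hJ2,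
    map_zero] at this

/-- The `r × r` matrix with ones on the antidiagonal and zeros elsewhere. -/
def antidiagonalMatrix (r : ℕ) (R : Type*) [CommRing R] : Matrix (Fin r) (Fin r) R :=
  Matrix.of fun i j => if j = i.rev then 1 else 0

/-- The Gram matrix `J̃` of the symplectic form on `E = R^{2r}` in the standard basis, whose first
`r` vectors are indexed by the left and whose last `r` vectors by the right summand of
`Fin r ⊕ Fin r`. -/
def formMatrix (r : ℕ) (R : Type*) [CommRing R] : Matrix (Fin r ⊕ Fin r) (Fin r ⊕ Fin r) R :=
  Matrix.fromBlocks 0 (antidiagonalMatrix r R) (-antidiagonalMatrix r R) 0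

theorem antidiagonalMatrix_mul_self (r : ℕ) (R : Type*) [CommRing R] :
    antidiagonalMatrix r R * antidiagonalMatrix r R = 1 := by
  ext i j
  simp only [antidiagonalMatrix, Matrix.mul_apply, Matrix.of_apply, Matrix.one_apply, ite_mul,
    one_mul, zero_mul, Finset.sum_ite_eq', Finset.mem_univ, if_true, 
    Fin.rev_rev, eq_comm]

theorem formMatrix_mul_self (r : ℕ) (R : Type*) [CommRing R] :
    formMatrix r R * formMatrix r R = -1 := by
  simp [formMatrix, Matrix.fromBlocks_multiply, antidiagonalMatrix_mul_self,
    ← Matrix.fromBlocks_one, Matrix.fromBlocks_neg]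

theorem map_formMatrix (r : ℕ) {R S F : Type*} [CommRing R] [CommRing S] [FunLike F R S]
    [RingHomClass F R S] (f : F) : (formMatrix r R).map f = formMatrix r S := by
  ext (i | i) (j | j) <;> simp [formMatrix, antidiagonalMatrix, apply_ite f]

theorem formMatrix_apply_swap (r : ℕ) (R : Type*) [CommRing R] (i j : Fin r ⊕ Fin r) :
    formMatrix r R i j = -formMatrix r R j i := by
  have h : ∀ i j : Fin r, j = i.rev ↔ i = j.rev := fun i j => by rw [← Fin.rev_eq_iff, eq_comm]
  rcases i with i | i <;> rcases j with j | j <;> simp [formMatrix, antidiagonalMatrix, h i j]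

theorem formMatrix_transpose (r : ℕ) (R : Type*) [CommRing R] :
    (formMatrix r R)ᵀ = -formMatrix r R := by
  ext1 i j
  exact formMatrix_apply_swap r R j i

/-- The matrix of coordinate functions on the space of `m × n` matrices. -/
def genericMatrix (m n : Type) (R : Type u) [CommRing R] :
    Matrix m n (MvPolynomial (m × n) R) :=
  Matrix.of fun i j => MvPolynomial.X (i, j)

theorem map_genericMatrix_aeval {m n : Type} {R : Type u} [CommRing R] {B : Type*} [CommRing B]
    [Algebra R B] (g : Matrix m n B) :
    (genericMatrix m n R).map (MvPolynomial.aeval (R := R) fun p : m × n => g p.1 p.2) = g := by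
  ext i j
  simp [genericMatrix]

/-- The ideal of the equations `ᵗZ J̃ Z = J̃` of the symplectic group. -/
def symplecticIdeal (r : ℕ) (R : Type u) [CommRing R] :
    Ideal (MvPolynomial ((Fin r ⊕ Fin r) × (Fin r ⊕ Fin r)) R) :=
  Ideal.span (Set.range fun p : (Fin r ⊕ Fin r) × (Fin r ⊕ Fin r) =>
    ((genericMatrix (Fin r ⊕ Fin r) (Fin r ⊕ Fin r) R)ᵀ * (formMatrix r R).map MvPolynomial.C *
      genericMatrix (Fin r ⊕ Fin r) (Fin r ⊕ Fin r) R -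
        (formMatrix r R).map MvPolynomial.C : Matrix (Fin r ⊕ Fin r) (Fin r ⊕ Fin r)
          (MvPolynomial ((Fin r ⊕ Fin r) × (Fin r ⊕ Fin r)) R)) p.1 p.2)

/-- The coordinate ring of the symplectic group of `E = R^{2r}`. -/
def SymplecticRing (r : ℕ) (R : Type u) [CommRing R] : Type u :=
  MvPolynomial ((Fin r ⊕ Fin r) × (Fin r ⊕ Fin r)) R ⧸ symplecticIdeal r R

namespace SymplecticRing
variable (r : ℕ) (R : Type u) [CommRing R]

instance : CommRing (SymplecticRing r R) :=
  inferInstanceAs (CommRing (_ ⧸ symplecticIdeal r R))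

instance : Algebra R (SymplecticRing r R) :=
  inferInstanceAs (Algebra R (_ ⧸ symplecticIdeal r R))

/-- The quotient map. -/
def mk : MvPolynomial ((Fin r ⊕ Fin r) × (Fin r ⊕ Fin r)) R →ₐ[R] SymplecticRing r R :=
  Ideal.Quotient.mkₐ R (symplecticIdeal r R)

/-- The generic symplectic matrix. -/
def generic : Matrix (Fin r ⊕ Fin r) (Fin r ⊕ Fin r) (SymplecticRing r R) :=
  (genericMatrix _ _ R).map (mk r R)

theorem generic_rel : (generic r R)ᵀ * formMatrix r _ * generic r R = formMatrix r _ := by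
  rw [generic, ← map_formMatrix r (mk r R), ← Matrix.transpose_map,
    ← Matrix.map_mul, ← Matrix.map_mul]
  ext i j
  refine Ideal.Quotient.eq.2 (Ideal.subset_span ⟨(i, j), ?_⟩)
  simp only [map_formMatrix, Matrix.sub_apply]

variable {r R} {B : Type*} [CommRing B] [Algebra R B]

/-- The `B`-point of the symplectic group given by a matrix. -/
def lift (g : Matrix (Fin r ⊕ Fin r) (Fin r ⊕ Fin r) B)
    (hg : gᵀ * formMatrix r B * g = formMatrix r B) : SymplecticRing r R →ₐ[R] B :=
  Ideal.Quotient.liftₐ (symplecticIdeal r R) (MvPolynomial.aeval fun p => g p.1 p.2) (by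
    intro a ha
    have : symplecticIdeal r R ≤ RingHom.ker (MvPolynomial.aeval (R := R) fun p => g p.1 p.2) := by
      refine Ideal.span_le.2 ?_
      rintro _ ⟨⟨i, j⟩, rfl⟩
      set φ : MvPolynomial ((Fin r ⊕ Fin r) × (Fin r ⊕ Fin r)) R →ₐ[R] B :=
        MvPolynomial.aeval fun p => g p.1 p.2 with hφ
      have hZ : (genericMatrix _ _ R).map φ = g := map_genericMatrix_aeval g
      simp only [SetLike.mem_coe, RingHom.mem_ker, map_formMatrix, Matrix.sub_apply, map_sub]
      rw [← Matrix.map_apply (f := φ), ← Matrix.map_apply (f := φ), Matrix.map_mul, Matrix.map_mul,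
        Matrix.transpose_map, hZ,
        map_formMatrix, hg, sub_self]
    exact this ha)

theorem lift_generic (g : Matrix (Fin r ⊕ Fin r) (Fin r ⊕ Fin r) B)
    (hg : gᵀ * formMatrix r B * g = formMatrix r B) :
    (generic r R).map (lift (R := R) g hg) = g := by
  rw [generic]
  exact map_genericMatrix_aeval g

theorem algHom_ext {f g : SymplecticRing r R →ₐ[R] B}
    (h : (generic r R).map f = (generic r R).map g) : f = g := by
  refine Ideal.Quotient.algHom_ext _ (MvPolynomial.algHom_ext fun p => ?_)
  exact congrFun (congrFun h p.1) p.2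

theorem map_generic_rel (f : SymplecticRing r R →ₐ[R] B) :
    ((generic r R).map f)ᵀ * formMatrix r B * (generic r R).map f = formMatrix r B := by
  have := congrArg (fun M => M.map f) (generic_rel r R)
  simpa only [Matrix.map_mul, Matrix.transpose_map, map_formMatrix] using this

theorem rel_mul {g h : Matrix (Fin r ⊕ Fin r) (Fin r ⊕ Fin r) B}
    (hg : gᵀ * formMatrix r B * g = formMatrix r B)
    (hh : hᵀ * formMatrix r B * h = formMatrix r B) :
    (g * h)ᵀ * formMatrix r B * (g * h) = formMatrix r B := by
  calc (g * h)ᵀ * formMatrix r B * (g * h) = hᵀ * (gᵀ * formMatrix r B * g) * h := by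
        simp only [Matrix.transpose_mul, Matrix.mul_assoc]
    _ = _ := by rw [hg, hh]

theorem rel_inv_mul {g : Matrix (Fin r ⊕ Fin r) (Fin r ⊕ Fin r) B}
    (hg : gᵀ * formMatrix r B * g = formMatrix r B) :
    (-(formMatrix r B * gᵀ * formMatrix r B)) * g = 1 := by
  rw [Matrix.neg_mul, Matrix.mul_assoc, Matrix.mul_assoc, ← Matrix.mul_assoc gᵀ, hg,
    formMatrix_mul_self, neg_neg]

theorem rel_inv {g : Matrix (Fin r ⊕ Fin r) (Fin r ⊕ Fin r) B}
    (hg : gᵀ * formMatrix r B * g = formMatrix r B) :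
    (-(formMatrix r B * gᵀ * formMatrix r B))ᵀ * formMatrix r B *
      (-(formMatrix r B * gᵀ * formMatrix r B)) = formMatrix r B := by
  set h := -(formMatrix r B * gᵀ * formMatrix r B) with hh
  have h1 : h * g = 1 := rel_inv_mul hg
  have h2 : g * h = 1 := mul_eq_one_comm.1 h1
  have h3 : hᵀ * gᵀ = 1 := by rw [← Matrix.transpose_mul, h2, Matrix.transpose_one]
  calc hᵀ * formMatrix r B * h = hᵀ * (gᵀ * formMatrix r B * g) * h := by rw [hg]
    _ = (hᵀ * gᵀ) * formMatrix r B * (g * h) := by simp only [Matrix.mul_assoc]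
    _ = _ := by rw [h2, h3, Matrix.one_mul, Matrix.mul_one]

open scoped TensorProduct
open Algebra.TensorProduct (includeLeft includeRight)

theorem map_comp_matrix {m n A B C : Type*} [CommRing A] [CommRing B] [CommRing C] [Algebra R A]
    [Algebra R B] [Algebra R C] (M : Matrix m n A) (f : A →ₐ[R] B) (g : B →ₐ[R] C) :
    (M.map f).map g = M.map (g.comp f) := rfl

variable (r R)

/-- Comultiplication, dual to matrix multiplication. -/
def comul : SymplecticRing r R →ₐ[R] SymplecticRing r R ⊗[R] SymplecticRing r R :=
  lift ((generic r R).map (includeLeft (R := R) (S := R) (B := SymplecticRing r R)) *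
      (generic r R).map (includeRight (R := R) (A := SymplecticRing r R)))
    (rel_mul (map_generic_rel _) (map_generic_rel _))

/-- Counit, dual to the identity matrix. -/
def counit : SymplecticRing r R →ₐ[R] R :=
  lift 1 (by simp)

/-- Antipode, dual to matrix inversion. -/
def antipode : SymplecticRing r R →ₐ[R] SymplecticRing r R :=
  lift (-(formMatrix r _ * (generic r R)ᵀ * formMatrix r _)) (rel_inv (generic_rel r R))

theorem map_comul : (generic r R).map (comul r R) =
    (generic r R).map (includeLeft (R := R) (S := R) (B := SymplecticRing r R)) *
      (generic r R).map (includeRight (R := R) (A := SymplecticRing r R)) := lift_generic _ _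

theorem map_counit : (generic r R).map (counit r R) = 1 := lift_generic _ _

theorem map_antipode : (generic r R).map (antipode r R) =
    -(formMatrix r _ * (generic r R)ᵀ * formMatrix r _) := lift_generic _ _


instance : Bialgebra R (SymplecticRing r R) :=
  Bialgebra.ofAlgHom (comul r R) (counit r R)
    (by
      refine algHom_ext ?_
      simp only [← map_comp_matrix, map_comul, Matrix.map_mul]
      have h1 : (((generic r R).map (includeLeft (R := R) (S := R) (B := SymplecticRing r R))).map
          (Algebra.TensorProduct.map (comul r R) (.id R (SymplecticRing r R)))) =
          ((generic r R).map (comul r R)).map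
            (includeLeft (R := R) (S := R) (B := SymplecticRing r R)) := by
        ext i j; simp
      have h2 : (((generic r R).map (includeRight (R := R) (A := SymplecticRing r R))).map
          (Algebra.TensorProduct.map (.id R (SymplecticRing r R)) (comul r R))) =
          ((generic r R).map (comul r R)).map
            (includeRight (R := R) (A := SymplecticRing r R)) := by
        ext i j; simp
      rw [h1, h2, map_comul, Matrix.map_mul, Matrix.map_mul, Matrix.map_mul, Matrix.mul_assoc]
      refine congrArg₂ _ ?_ (congrArg₂ _ ?_ ?_)
      · ext i j; simp [Algebra.TensorProduct.one_def]
      · ext i j; simp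
      · ext i j; simp [Algebra.TensorProduct.one_def])
    (by
      refine algHom_ext ?_
      simp only [← map_comp_matrix, map_comul, Matrix.map_mul]
      have h1 : (((generic r R).map (includeLeft (R := R) (S := R) (B := SymplecticRing r R))).map
          (Algebra.TensorProduct.map (counit r R) (.id R (SymplecticRing r R)))) =
          ((generic r R).map (counit r R)).map
            (includeLeft (R := R) (S := R) (B := SymplecticRing r R)) := by
        ext i j; simp
      rw [h1, map_counit, Matrix.map_one _ (map_zero _) (map_one _), Matrix.one_mul]
      ext i j; simp)
    (by
      refine algHom_ext ?_
      simp only [← map_comp_matrix, map_comul, Matrix.map_mul]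
      have h1 : (((generic r R).map (includeRight (R := R) (A := SymplecticRing r R))).map
          (Algebra.TensorProduct.map (.id R (SymplecticRing r R)) (counit r R))) =
          ((generic r R).map (counit r R)).map
            (includeRight (R := R) (A := SymplecticRing r R)) := by
        ext i j; simp
      rw [h1, map_counit, Matrix.map_one _ (map_zero _) (map_one _), Matrix.mul_one]
      ext i j; simp)

instance : HopfAlgebra R (SymplecticRing r R) :=
  HopfAlgebra.ofAlgHom (antipode r R)
    (by
      refine algHom_ext ?_
      change (generic r R).map ((Algebra.TensorProduct.lift (antipode r R) (.id R _)
        fun _ _ ↦ Commute.all _ _).comp (comul r R)) =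
          (generic r R).map ((Algebra.ofId R _).comp (counit r R))
      simp only [← map_comp_matrix, map_comul, Matrix.map_mul, map_counit]
      have h1 : ((generic r R).map (includeLeft (R := R) (S := R) (B := SymplecticRing r R))).map
          (Algebra.TensorProduct.lift (antipode r R) (AlgHom.id R (SymplecticRing r R)) fun _ _ ↦
            Commute.all _ _) = (generic r R).map (antipode r R) := by
        ext i j; simp
      have h2 : ((generic r R).map (includeRight (R := R) (A := SymplecticRing r R))).map
          (Algebra.TensorProduct.lift (antipode r R) (AlgHom.id R (SymplecticRing r R)) fun _ _ ↦
            Commute.all _ _) = (generic r R).map (AlgHom.id R (SymplecticRing r R)) := by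
        ext i j; simp
      rw [h1, h2, map_antipode, Matrix.map_one _ (map_zero _) (map_one _)]
      exact rel_inv_mul (generic_rel r R))
    (by
      refine algHom_ext ?_
      change (generic r R).map ((Algebra.TensorProduct.lift (.id R _) (antipode r R)
        fun _ _ ↦ Commute.all _ _).comp (comul r R)) =
          (generic r R).map ((Algebra.ofId R _).comp (counit r R))
      simp only [← map_comp_matrix, map_comul, Matrix.map_mul, map_counit]
      have h1 : ((generic r R).map (includeLeft (R := R) (S := R) (B := SymplecticRing r R))).map
          (Algebra.TensorProduct.lift (AlgHom.id R (SymplecticRing r R)) (antipode r R) fun _ _ ↦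
            Commute.all _ _) = (generic r R).map (AlgHom.id R (SymplecticRing r R)) := by
        ext i j; simp
      have h2 : ((generic r R).map (includeRight (R := R) (A := SymplecticRing r R))).map
          (Algebra.TensorProduct.lift (AlgHom.id R (SymplecticRing r R)) (antipode r R) fun _ _ ↦
            Commute.all _ _) = (generic r R).map (antipode r R) := by
        ext i j; simp
      rw [h1, h2, map_antipode, Matrix.map_one _ (map_zero _) (map_one _)]
      exact mul_eq_one_comm.1 (rel_inv_mul (generic_rel r R)))

end SymplecticRing

/-! ### Coordinate rings -/

/-- The coordinate ring of `M = Hom(V, E)` with `V = R^n`, `E = R^{2r}`. -/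
abbrev HomRing (r n : ℕ) (R : Type u) [CommRing R] : Type u :=
  MvPolynomial ((Fin r ⊕ Fin r) × Fin n) R

/-- The coordinate ring of the affine space of alternating `n × n` matrices. -/
abbrev AltRing (n : ℕ) (R : Type u) [CommRing R] : Type u :=
  MvPolynomial {p : Fin n × Fin n // p.1 < p.2} R

/-- The alternating matrix whose entry above the diagonal at `(i, j)` is `a (i, j)`. -/
def alternatingMatrix {n : ℕ} {B : Type*} [CommRing B] (a : {p : Fin n × Fin n // p.1 < p.2} → B) :
    Matrix (Fin n) (Fin n) B :=
  Matrix.of fun i j =>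
    if h : i < j then a ⟨(i, j), h⟩ else if h : j < i then -a ⟨(j, i), h⟩ else 0

/-- The matrix of coordinate functions on the space of alternating `n × n` matrices. -/
def genericAlternating (n : ℕ) (R : Type u) [CommRing R] : Matrix (Fin n) (Fin n) (AltRing n R) :=
  alternatingMatrix MvPolynomial.X

/-- The ideal generated by the Pfaffians of the main `2s × 2s` submatrices. -/
def pfaffianIdeal (n s : ℕ) (R : Type u) [CommRing R] : Ideal (AltRing n R) :=
  Ideal.span (Set.range fun e : Fin (2 * s) ↪o Fin n =>
    pfaffian ((genericAlternating n R).submatrix e e))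

/-- The coordinate ring of the Pfaffian scheme `Y_s`. -/
def PfaffianRing (n s : ℕ) (R : Type u) [CommRing R] : Type u :=
  AltRing n R ⧸ pfaffianIdeal n s R

namespace PfaffianRing
variable (n s : ℕ) (R : Type u) [CommRing R]

instance : CommRing (PfaffianRing n s R) :=
  inferInstanceAs (CommRing (_ ⧸ pfaffianIdeal n s R))

instance : Algebra R (PfaffianRing n s R) :=
  inferInstanceAs (Algebra R (_ ⧸ pfaffianIdeal n s R))

/-- The restriction of functions from the space of alternating matrices to `Y_s`. -/
def mk : AltRing n R →ₐ[R] PfaffianRing n s R :=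
  Ideal.Quotient.mkₐ R (pfaffianIdeal n s R)

/-- The tautological alternating matrix on `Y_s`. -/
def generic : Matrix (Fin n) (Fin n) (PfaffianRing n s R) :=
  (genericAlternating n R).map (mk n s R)

end PfaffianRing

section comorphisms

open scoped TensorProduct
open Algebra.TensorProduct (includeLeft includeRight)

variable (r n : ℕ) (R : Type u) [CommRing R]

/-- The comorphism of the action `(g, φ) ↦ g φ` of the symplectic group on `Hom(V, E)`. -/
def coaction : HomRing r n R →ₐ[R] SymplecticRing r R ⊗[R] HomRing r n R :=
  MvPolynomial.aeval fun p =>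
    ((SymplecticRing.generic r R).map
        (includeLeft (R := R) (S := R) (B := HomRing r n R)) *
      (genericMatrix (Fin r ⊕ Fin r) (Fin n) R).map
        (includeRight (R := R) (A := SymplecticRing r R))) p.1 p.2

/-- The pulled back form `ᵗX J̃ X` for the generic `X`. -/
def pulledBackForm : Matrix (Fin n) (Fin n) (HomRing r n R) :=
  (genericMatrix (Fin r ⊕ Fin r) (Fin n) R)ᵀ * formMatrix r (HomRing r n R) *
    genericMatrix (Fin r ⊕ Fin r) (Fin n) R

/-- The comorphism of `φ ↦ ρ ∘ ⋀²φ`, as a map from `Hom(V, E)` to all alternating matrices. -/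
def coquotientAux : AltRing n R →ₐ[R] HomRing r n R :=
  MvPolynomial.aeval fun p => pulledBackForm r n R p.1.1 p.1.2

variable {R} in
theorem conj_formMatrix_diag {B : Type*} [CommRing B] (X : Matrix (Fin r ⊕ Fin r) (Fin n) B)
    (i : Fin n) : (Xᵀ * formMatrix r B * X) i i = 0 := by
  simp only [formMatrix, Matrix.mul_apply, Matrix.transpose_apply, Fintype.sum_sum_type,
    Matrix.fromBlocks_apply₁₁, Matrix.fromBlocks_apply₁₂, Matrix.fromBlocks_apply₂₁,
    Matrix.fromBlocks_apply₂₂, antidiagonalMatrix, Matrix.of_apply, Matrix.neg_apply,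
    Matrix.zero_apply]
  have h : ∀ i j : Fin r, j = i.rev ↔ i = j.rev := fun i j => by rw [← Fin.rev_eq_iff, eq_comm]
  simp only [h, mul_zero, Finset.sum_const_zero, mul_neg, mul_ite, mul_one, zero_add, add_zero,
    Finset.sum_neg_distrib, Finset.sum_ite_eq', Finset.mem_univ, if_true]
  rw [← Equiv.sum_comp Fin.revPerm fun x => -X (Sum.inr x.rev) i * X (Sum.inl x) i]
  simp [mul_comm]

theorem map_genericAlternating_coquotientAux :
    (genericAlternating n R).map (coquotientAux r n R) = pulledBackForm r n R := by
  ext1 i j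
  simp only [Matrix.map_apply, genericAlternating, alternatingMatrix, Matrix.of_apply]
  split_ifs with h h'
  · exact MvPolynomial.aeval_X _ _
  · rw [map_neg]
    refine (congrArg _ (MvPolynomial.aeval_X _ _)).trans ?_
    have : (pulledBackForm r n R)ᵀ = -pulledBackForm r n R := by
      simp [pulledBackForm, Matrix.transpose_mul, formMatrix_transpose, Matrix.mul_assoc]
    exact (congrFun (congrFun this j) i).symm.trans rfl
  · obtain rfl : i = j := le_antisymm (not_lt.1 h') (not_lt.1 h)
    rw [map_zero]
    exact (conj_formMatrix_diag r n _ i).symm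

/-- The comorphism of `π : Hom(V, E) → Y_s`, `φ ↦ ρ ∘ ⋀²φ`. -/
def coquotient (s : ℕ) (h : r < s) : PfaffianRing n s R →ₐ[R] HomRing r n R :=
  Ideal.Quotient.liftₐ (pfaffianIdeal n s R) (coquotientAux r n R) (by
    intro a ha
    have : pfaffianIdeal n s R ≤ RingHom.ker (coquotientAux r n R) := by
      refine Ideal.span_le.2 ?_
      rintro _ ⟨e, rfl⟩
      have key := pfaffian_conj_eq_zero (m := s) (ι := Fin r ⊕ Fin r) (by simp; omega)
        (formMatrix r ℤ) (formMatrix_apply_swap r ℤ)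
        ((genericMatrix (Fin r ⊕ Fin r) (Fin n) R).submatrix id e)
      have hJ : (formMatrix r ℤ).map (Int.cast : ℤ → HomRing r n R) = formMatrix r _ :=
        map_formMatrix r (Int.castRingHom (HomRing r n R))
      rw [SetLike.mem_coe, RingHom.mem_ker, ← AlgHom.coe_toRingHom, map_pfaffian,
        AlgHom.coe_toRingHom, ← Matrix.submatrix_map, map_genericAlternating_coquotientAux]
      rw [hJ] at key
      exact key
    exact this ha)

end comorphisms

/-! ### The symplectic group scheme, its action and the quotient morphism -/

section coactionAxioms

open scoped TensorProduct
open Algebra.TensorProduct (includeLeft includeRight)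

variable (r n : ℕ) (R : Type u) [CommRing R]

theorem map_coaction : (genericMatrix (Fin r ⊕ Fin r) (Fin n) R).map (coaction r n R) =
    (SymplecticRing.generic r R).map (includeLeft (R := R) (S := R) (B := HomRing r n R)) *
      (genericMatrix (Fin r ⊕ Fin r) (Fin n) R).map
        (includeRight (R := R) (A := SymplecticRing r R)) :=
  map_genericMatrix_aeval _

theorem HomRing.algHom_ext {r n : ℕ} {R : Type u} [CommRing R] {B : Type*} [CommRing B]
    [Algebra R B] {f g : HomRing r n R →ₐ[R] B}
    (h : (genericMatrix (Fin r ⊕ Fin r) (Fin n) R).map f =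
      (genericMatrix (Fin r ⊕ Fin r) (Fin n) R).map g) : f = g :=
  MvPolynomial.algHom_ext fun p => congrFun (congrFun h p.1) p.2

theorem counit_coaction :
    (Algebra.TensorProduct.map (Bialgebra.counitAlgHom R (SymplecticRing r R))
      (AlgHom.id R (HomRing r n R))).comp (coaction r n R) =
      (Algebra.TensorProduct.lid R (HomRing r n R)).symm.toAlgHom := by
  refine HomRing.algHom_ext ?_
  have h1 : ((SymplecticRing.generic r R).map
      (includeLeft (R := R) (S := R) (B := HomRing r n R))).map
      (Algebra.TensorProduct.map (Bialgebra.counitAlgHom R (SymplecticRing r R))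
        (AlgHom.id R (HomRing r n R))) =
      ((SymplecticRing.generic r R).map (SymplecticRing.counit r R)).map
        (includeLeft (R := R) (S := R) (B := HomRing r n R)) := by
    ext i j
    exact (Algebra.TensorProduct.map_tmul _ _ _ _).trans (by simp; rfl)
  rw [← SymplecticRing.map_comp_matrix, map_coaction, Matrix.map_mul, h1,
    SymplecticRing.map_counit, Matrix.map_one _ (map_zero _) (map_one _), Matrix.one_mul]
  ext i j
  simp

theorem comul_coaction :
    (Algebra.TensorProduct.map (Bialgebra.comulAlgHom R (SymplecticRing r R))
      (AlgHom.id R (HomRing r n R))).comp (coaction r n R) =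
    (Algebra.TensorProduct.assoc R R R _ _ _).symm.toAlgHom.comp
      ((Algebra.TensorProduct.map (AlgHom.id R (SymplecticRing r R)) (coaction r n R)).comp
        (coaction r n R)) := by
  refine HomRing.algHom_ext ?_
  have h1 : ((SymplecticRing.generic r R).map
      (includeLeft (R := R) (S := R) (B := HomRing r n R))).map
      (Algebra.TensorProduct.map (Bialgebra.comulAlgHom R (SymplecticRing r R))
        (AlgHom.id R (HomRing r n R))) =
      ((SymplecticRing.generic r R).map (SymplecticRing.comul r R)).map
        (includeLeft (R := R) (S := R) (B := HomRing r n R)) := by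
    ext i j
    exact (Algebra.TensorProduct.map_tmul _ _ _ _).trans (by simp; rfl)
  have h2 : ((genericMatrix (Fin r ⊕ Fin r) (Fin n) R).map
        (includeRight (R := R) (A := SymplecticRing r R))).map
      (Algebra.TensorProduct.map (AlgHom.id R (SymplecticRing r R)) (coaction r n R)) =
      ((genericMatrix (Fin r ⊕ Fin r) (Fin n) R).map (coaction r n R)).map
        (includeRight (R := R) (A := SymplecticRing r R)) := by
    ext i j
    simp
  change ((genericMatrix (Fin r ⊕ Fin r) (Fin n) R).map (coaction r n R)).map
      (Algebra.TensorProduct.map (Bialgebra.comulAlgHom R (SymplecticRing r R))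
        (AlgHom.id R (HomRing r n R))) =
    (((genericMatrix (Fin r ⊕ Fin r) (Fin n) R).map (coaction r n R)).map
      (Algebra.TensorProduct.map (AlgHom.id R (SymplecticRing r R)) (coaction r n R))).map
        (Algebra.TensorProduct.assoc R R R (SymplecticRing r R) (SymplecticRing r R)
          (HomRing r n R)).symm
  rw [map_coaction, Matrix.map_mul, h1, SymplecticRing.map_comul,
    Matrix.map_mul, Matrix.map_mul, h2, map_coaction, Matrix.map_mul, Matrix.map_mul,
    Matrix.map_mul, Matrix.mul_assoc]
  refine congrArg₂ _ ?_ (congrArg₂ _ ?_ ?_)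
  · ext i j; simp [Algebra.TensorProduct.one_def]
  · ext i j; simp
  · ext i j; simp [Algebra.TensorProduct.one_def]

/-- `π` is invariant, on the level of comorphisms. -/
theorem coaction_comp_coquotient (s : ℕ) (h : r < s) :
    (coaction r n R).comp (coquotient r n R s h) =
      (includeRight (R := R) (A := SymplecticRing r R)).comp (coquotient r n R s h) := by
  refine Ideal.Quotient.algHom_ext _ (MvPolynomial.algHom_ext fun p => ?_)
  have key : (pulledBackForm r n R).map (coaction r n R) =
      (pulledBackForm r n R).map (includeRight (R := R) (A := SymplecticRing r R)) := by
    simp only [pulledBackForm, Matrix.map_mul, Matrix.transpose_map, map_coaction, map_formMatrix,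
      Matrix.transpose_mul]
    conv_rhs => rw [← SymplecticRing.map_generic_rel
      (includeLeft (R := R) (S := R) (A := SymplecticRing r R) (B := HomRing r n R))]
    simp only [Matrix.mul_assoc]
  have h0 : coquotientAux r n R (MvPolynomial.X p) = pulledBackForm r n R p.1.1 p.1.2 :=
    MvPolynomial.aeval_X _ _
  change coaction r n R (coquotientAux r n R (MvPolynomial.X p)) =
    includeRight (R := R) (A := SymplecticRing r R) (coquotientAux r n R (MvPolynomial.X p))
  rw [h0]
  exact congrFun (congrFun key p.1.1) p.1.2

end coactionAxioms

open CategoryTheory AlgebraicGeometry MonoidalCategory CartesianMonoidalCategory Opposite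
open scoped MonObj

/-- A lax monoidal functor sends actions to actions. -/
abbrev mapModObj {C D : Type*} [Category C] [Category D] [MonoidalCategory C] [MonoidalCategory D]
    (F : C ⥤ D) [F.LaxMonoidal] (G X : C) [MonObj G] [ModObj G X] :
    letI := F.monObjObj (X := G)
    ModObj (F.obj G) (F.obj X) :=
  letI := F.monObjObj (X := G)
  { smul := Functor.LaxMonoidal.μ F G X ≫ F.map γ[G, X]
    one_smul := by
      change (Functor.LaxMonoidal.ε F ≫ F.map η[G]) ▷ F.obj X ≫
        Functor.LaxMonoidal.μ F G X ≫ F.map γ[G, X] = (λ_ (F.obj X)).hom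
      simp only [comp_whiskerRight, Category.assoc, Functor.LaxMonoidal.μ_natural_left_assoc,
        ← F.map_comp, ModObj.one_smul_self, ← Functor.LaxMonoidal.left_unitality]
    mul_smul := by
      change (Functor.LaxMonoidal.μ F G G ≫ F.map μ[G]) ▷ F.obj X ≫
        Functor.LaxMonoidal.μ F G X ≫ F.map γ[G, X] = (α_ (F.obj G) (F.obj G) (F.obj X)).hom ≫
          F.obj G ◁ (Functor.LaxMonoidal.μ F G X ≫ F.map γ[G, X]) ≫
            Functor.LaxMonoidal.μ F G X ≫ F.map γ[G, X]
      simp only [comp_whiskerRight, Category.assoc, Functor.LaxMonoidal.μ_natural_left_assoc,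
        ← F.map_comp, ModObj.mul_smul_self, MonoidalCategory.whiskerLeft_comp,
        Functor.LaxMonoidal.μ_natural_right_assoc]
      simp only [F.map_comp, Functor.LaxMonoidal.associativity_assoc] }

section schemes

variable (r n : ℕ) (k : Type u) [CommRing k]

instance algSpecMonoidal : (algSpec (CommRingCat.of k)).Monoidal :=
  (braidedAlgSpec (R := CommRingCat.of k)).toMonoidal

/-- The affine `k`-scheme with coordinate ring `A`. -/
abbrev specOver (A : Type u) [CommRing A] [Algebra k A] : Over (Spec (CommRingCat.of k)) :=
  (algSpec (CommRingCat.of k)).obj (op (CommAlgCat.of k A))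

/-- The symplectic group scheme of `E = k^{2r}`. -/
def symplecticGroupScheme : Over (Spec (CommRingCat.of k)) :=
  specOver k (SymplecticRing r k)

instance : GrpObj (symplecticGroupScheme r k) :=
  (algSpec (CommRingCat.of k)).grpObjObj (G := op (CommAlgCat.of k (SymplecticRing r k)))

/-- The scheme `M = Hom(V, E)`. -/
def homScheme : Over (Spec (CommRingCat.of k)) :=
  specOver k (HomRing r n k)

instance modObjOp : ModObj (op (CommAlgCat.of k (SymplecticRing r k)))
    (op (CommAlgCat.of k (HomRing r n k))) where
  smul := (CommAlgCat.ofHom (coaction r n k)).op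
  one_smul := by
    apply Quiver.Hom.unop_inj
    ext1
    exact counit_coaction r n k
  mul_smul := by
    apply Quiver.Hom.unop_inj
    ext1
    exact comul_coaction r n k

/-- The natural action of the symplectic group on `M = Hom(V, E)`. -/
instance : ModObj (symplecticGroupScheme r k) (homScheme r n k) :=
  mapModObj (algSpec (CommRingCat.of k)) (op (CommAlgCat.of k (SymplecticRing r k)))
    (op (CommAlgCat.of k (HomRing r n k)))

end schemes

section quotient

variable (r n s : ℕ) (k : Type u) [CommRing k]

/-- The scheme `Y_s` of alternating `n × n` matrices all of whose main `2s × 2s` submatrices have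
vanishing Pfaffian. -/
def pfaffianScheme : Over (Spec (CommRingCat.of k)) :=
  specOver k (PfaffianRing n s k)

/-- The morphism `π : Hom(V, E) → Y_s`, `φ ↦ ρ ∘ ⋀²φ`, where `2r = dim E` and `r < s`. -/
def quotientMorphism (h : r < s) : homScheme r n k ⟶ pfaffianScheme n s k :=
  (algSpec (CommRingCat.of k)).map (CommAlgCat.ofHom (coquotient r n k s h)).op

/-- `π` is invariant under the symplectic group. -/
theorem smul_quotientMorphism (h : r < s) :
    γ[symplecticGroupScheme r k, homScheme r n k] ≫ quotientMorphism r n s k h =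
      snd (symplecticGroupScheme r k) (homScheme r n k) ≫ quotientMorphism r n s k h := by
  let F := algSpec (CommRingCat.of k)
  let A : (CommAlgCat k)ᵒᵖ := op (CommAlgCat.of k (SymplecticRing r k))
  let T : (CommAlgCat k)ᵒᵖ := op (CommAlgCat.of k (HomRing r n k))
  let Y : (CommAlgCat k)ᵒᵖ := op (CommAlgCat.of k (PfaffianRing n s k))
  let q : T ⟶ Y := (CommAlgCat.ofHom (coquotient r n k s h)).op
  have h1 : γ[A, T] ≫ q = snd A T ≫ q := by
    apply Quiver.Hom.unop_inj
    ext1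
    exact coaction_comp_coquotient r n k s h
  change (Functor.LaxMonoidal.μ F A T ≫ F.map γ[A, T]) ≫ F.map q =
    snd (F.obj A) (F.obj T) ≫ F.map q
  rw [Category.assoc, ← F.map_comp, h1, F.map_comp, ← Category.assoc, Functor.Monoidal.μ_snd]

/-- The affine space of alternating `n × n` matrices. -/
def altScheme : Over (Spec (CommRingCat.of k)) :=
  specOver k (AltRing n k)

/-- The inclusion of `Y_s` into the space of all alternating matrices. -/
def pfaffianInclusion : pfaffianScheme n s k ⟶ altScheme n k :=
  (algSpec (CommRingCat.of k)).map (CommAlgCat.ofHom (PfaffianRing.mk n s k)).op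

/-- The set of points `x` of the space of alternating `n × n` matrices such that the alternating
matrix over the residue field of `x` that corresponds to `x` has rank exactly `d`. -/
def exactRankLocus (d : ℕ) : Set (altScheme n k).left :=
  {x : PrimeSpectrum (AltRing n k) |
    ((genericAlternating n k).map (algebraMap (AltRing n k) x.asIdeal.ResidueField)).rank = d}

/-- The open subscheme `Y_s ∖ Y_r` of `Y_s`. -/
def pfaffianOpen : (pfaffianScheme n s k).left.Opens :=
  ⟨(PrimeSpectrum.zeroLocus
      ((pfaffianIdeal n r k).map (PfaffianRing.mk n s k) : Set (PfaffianRing n s k)))ᶜ,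
    (PrimeSpectrum.isClosed_zeroLocus _).isOpen_compl⟩

end quotient

section restriction

variable {S : Scheme.{u}}

/-- An open subscheme of an `S`-scheme, as an `S`-scheme. -/
def openSubscheme (X : Over S) (U : X.left.Opens) : Over S :=
  Over.mk (U.ι ≫ X.hom)

/-- The inclusion of an open subscheme. -/
def openSubschemeι (X : Over S) (U : X.left.Opens) : openSubscheme X U ⟶ X :=
  Over.homMk U.ι rfl

/-- The restriction `f⁻¹(U) → U` of `f : X → Y`. -/
def restrictHom {X Y : Over S} (f : X ⟶ Y) (U : Y.left.Opens) :
    openSubscheme X (f.left ⁻¹ᵁ U) ⟶ openSubscheme Y U :=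
  Over.homMk (f.left ∣_ U) (by simp [openSubscheme])

instance (X : Over S) (U : X.left.Opens) : Mono (openSubschemeι X U) := by
  have : Mono (openSubschemeι X U).left := inferInstanceAs (Mono U.ι)
  exact Over.mono_of_mono_left _

theorem smul_mem_preimage {G X Y : Over S} [MonObj G] [ModObj G X] (f : X ⟶ Y)
    (hf : γ[G, X] ≫ f = snd G X ≫ f) (U : Y.left.Opens) :
    Set.range (G ◁ openSubschemeι X (f.left ⁻¹ᵁ U) ≫ γ[G, X]).left ⊆
      Set.range (f.left ⁻¹ᵁ U).ι := by
  rintro _ ⟨p, rfl⟩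
  rw [Scheme.Opens.range_ι]
  change (f.left ((G ◁ openSubschemeι X (f.left ⁻¹ᵁ U) ≫ γ[G, X]).left p)) ∈ U
  have h1 : (G ◁ openSubschemeι X (f.left ⁻¹ᵁ U) ≫ γ[G, X]) ≫ f =
      snd G _ ≫ openSubschemeι X (f.left ⁻¹ᵁ U) ≫ f := by
    rw [Category.assoc, hf, whiskerLeft_snd_assoc]
  have h2 := congrArg (fun g => g.left p) h1
  simp only [Over.comp_left, Scheme.Hom.comp_apply] at h2 ⊢
  rw [h2]
  exact ((snd G (openSubscheme X (f.left ⁻¹ᵁ U))).left p).2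

/-- The action map `G × f⁻¹(U) → f⁻¹(U)` as a morphism of schemes. -/
def restrictSMulLeft {G X Y : Over S} [MonObj G] [ModObj G X] (f : X ⟶ Y)
    (hf : γ[G, X] ≫ f = snd G X ≫ f) (U : Y.left.Opens) :
    (G ⊗ openSubscheme X (f.left ⁻¹ᵁ U)).left ⟶ (f.left ⁻¹ᵁ U).toScheme :=
  IsOpenImmersion.lift (f.left ⁻¹ᵁ U).ι
    (G ◁ openSubschemeι X (f.left ⁻¹ᵁ U) ≫ γ[G, X]).left (smul_mem_preimage f hf U)

theorem restrictSMulLeft_ι {G X Y : Over S} [MonObj G] [ModObj G X] (f : X ⟶ Y)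
    (hf : γ[G, X] ≫ f = snd G X ≫ f) (U : Y.left.Opens) :
    restrictSMulLeft f hf U ≫ (f.left ⁻¹ᵁ U).ι =
      (G ◁ openSubschemeι X (f.left ⁻¹ᵁ U) ≫ γ[G, X]).left :=
  IsOpenImmersion.lift_fac _ _ _

/-- The action map `G × f⁻¹(U) → f⁻¹(U)`. -/
def restrictSMul {G X Y : Over S} [MonObj G] [ModObj G X] (f : X ⟶ Y)
    (hf : γ[G, X] ≫ f = snd G X ≫ f) (U : Y.left.Opens) :
    G ⊗ openSubscheme X (f.left ⁻¹ᵁ U) ⟶ openSubscheme X (f.left ⁻¹ᵁ U) :=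
  Over.homMk (restrictSMulLeft f hf U) (by
    have h1 : restrictSMulLeft f hf U ≫ (f.left ⁻¹ᵁ U).ι ≫ X.hom =
        (G ⊗ openSubscheme X (f.left ⁻¹ᵁ U)).hom := by
      rw [← Category.assoc, restrictSMulLeft_ι]
      exact Over.w _
    exact h1)

theorem restrictSMul_ι {G X Y : Over S} [MonObj G] [ModObj G X] (f : X ⟶ Y)
    (hf : γ[G, X] ≫ f = snd G X ≫ f) (U : Y.left.Opens) :
    restrictSMul f hf U ≫ openSubschemeι X (f.left ⁻¹ᵁ U) =
      G ◁ openSubschemeι X (f.left ⁻¹ᵁ U) ≫ γ[G, X] := by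
  ext1
  exact restrictSMulLeft_ι f hf U

/-- The restriction of an action on `X` to the preimage of an open subscheme under an invariant
morphism `f : X → Y`. -/
abbrev restrictModObj {G X Y : Over S} [MonObj G] [ModObj G X] (f : X ⟶ Y)
    (hf : γ[G, X] ≫ f = snd G X ≫ f) (U : Y.left.Opens) :
    ModObj G (openSubscheme X (f.left ⁻¹ᵁ U)) where
  smul := restrictSMul f hf U
  one_smul := by
    change η[G] ▷ openSubscheme X (f.left ⁻¹ᵁ U) ≫ restrictSMul f hf U = (λ_ _).hom
    rw [← cancel_mono (openSubschemeι X (f.left ⁻¹ᵁ U)), Category.assoc, restrictSMul_ι,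
      ← whisker_exchange_assoc, ModObj.one_smul_self, leftUnitor_naturality]
  mul_smul := by
    change μ[G] ▷ openSubscheme X (f.left ⁻¹ᵁ U) ≫ restrictSMul f hf U =
      (α_ _ _ _).hom ≫ G ◁ restrictSMul f hf U ≫ restrictSMul f hf U
    rw [← cancel_mono (openSubschemeι X (f.left ⁻¹ᵁ U))]
    simp only [Category.assoc, restrictSMul_ι]
    rw [← whisker_exchange_assoc, ModObj.mul_smul_self, ← whiskerLeft_comp_assoc, restrictSMul_ι]
    simp

/-- Let `G` be a group scheme over `S` that acts on `X`. A morphism `f : X → Y` of `S`-schemes is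
a principal `G`-bundle if it is faithfully flat and `G`-invariant and
`Φ : G × X → X ×_Y X`, `(g, x) ↦ (g x, x)`, is an isomorphism. -/
structure IsPrincipalBundle (G : Over S) {X Y : Over S} [GrpObj G] [ModObj G X] (f : X ⟶ Y) :
    Prop where
  flat : Flat f.left
  surjective : Surjective f.left
  invariant : γ[G, X] ≫ f = snd G X ≫ f
  isIso : IsIso (Limits.pullback.lift (f := f.left) (g := f.left) (γ[G, X] : G ⊗ X ⟶ X).left
    (snd G X).left (congrArg CommaMorphism.left invariant))

end restriction

section main

variable (r n s : ℕ) (h : r < s) (k : Type u) [CommRing k]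

/-- `π⁻¹(U)` for `U = Y_s ∖ Y_r`. -/
def quotientPreimage : Over (Spec (CommRingCat.of k)) :=
  openSubscheme (homScheme r n k) ((quotientMorphism r n s k h).left ⁻¹ᵁ pfaffianOpen r n s k)

instance : ModObj (symplecticGroupScheme r k) (quotientPreimage r n s h k) :=
  restrictModObj (quotientMorphism r n s k h) (smul_quotientMorphism r n s k h)
    (pfaffianOpen r n s k)

/-- The restriction `π⁻¹(U) → U` of `π`, for `U = Y_s ∖ Y_r`. -/
def restrictedQuotient : quotientPreimage r n s h k ⟶
    openSubscheme (pfaffianScheme n s k) (pfaffianOpen r n s k) :=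
  restrictHom (quotientMorphism r n s k h) (pfaffianOpen r n s k)

end main

end SymplecticInvariants

end

open SymplecticInvariants

noncomputable section
namespace SymplecticInvariants
universe u

/-! ### Alternating matrices -/

section alternating

variable {R S ι κ : Type*} [CommRing R] [CommRing S]

/-! Put `r = t - 1`, write `J` for the Gram matrix of the form, and let `A_ee` be the main submatrix
of `A` on an index set `e`. The open set `U` is covered by the loci where a main Pfaffian of size
`2r` is invertible, and everything follows from two matrix facts valid there.

Sections over local rings. Let `A` be alternating with all Pfaffians of size `2r + 2` zero and the
Pfaffian of `A_ee` a unit. Up to sign and units, the entry `(i, j)` of the Schur complement of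
`A_ee` is the Pfaffian on `e ∪ {i, j}`, so the complement vanishes and `A = A_{·e} A_ee⁻¹ A_{e·}`
(`IsAlternating.eq_mul_inv_mul`). Over a local ring `A_ee` has a symplectic basis, `A_ee = ᵗC J C`,
and `X = C A_ee⁻¹ A_{e·}` satisfies `ᵗX J X = A`.

Simple transitivity over any ring. If `X` and `Y` pull back the same form, and it is nondegenerate
on `e`, then the square blocks `X_e`, `Y_e` are invertible and `g = X_e Y_e⁻¹` is the only matrix
with `g Y = X`; it is symplectic (`existsUnique_symplectic`).

The second fact, read on points with values in an arbitrary scheme, says that `Φ` is an isomorphism.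
The first, over the local ring of `Y_t` at a point of `U`, gives a preimage of that point. Both
together give flatness: over that local ring `R` a section exists, so the base change of `M` is a
retract of `R × G` on the level of coordinate rings, and `R ⊗ k[G]` is flat over `R` because `k` is
a field.

The description of `U` by ranks is linear algebra over residue fields: rank `2r` means that the
Pfaffians of size `2r + 2` vanish and one of size `2r` does not. The Pfaffian identities are proved
for the generic alternating matrix over `ℤ`, in a domain of characteristic zero, and then
specialized; this covers characteristic 2 as well. -/

/-- A matrix is alternating if it is skew-symmetric with zeros on the diagonal. -/
structure IsAlternating (A : Matrix ι ι R) : Prop where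
  apply_swap : ∀ i j, A i j = -A j i
  apply_self : ∀ i, A i i = 0

namespace IsAlternating

theorem transpose_eq {A : Matrix ι ι R} (hA : IsAlternating A) : Aᵀ = -A := by
  ext1 i j
  exact hA.apply_swap j i

theorem submatrix {A : Matrix ι ι R} (hA : IsAlternating A) (e : κ → ι) :
    IsAlternating (A.submatrix e e) :=
  ⟨fun _ _ => hA.apply_swap _ _, fun _ => hA.apply_self _⟩

theorem map {A : Matrix ι ι R} (hA : IsAlternating A) (f : R →+* S) : IsAlternating (A.map f) :=
  ⟨fun i j => by simp [hA.apply_swap i j], fun i => by simp [hA.apply_self i]⟩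

theorem neg {A : Matrix ι ι R} (hA : IsAlternating A) : IsAlternating (-A) :=
  ⟨fun i j => by simp [hA.apply_swap i j], fun i => by simp [hA.apply_self i]⟩

theorem sub {A B : Matrix ι ι R} (hA : IsAlternating A) (hB : IsAlternating B) :
    IsAlternating (A - B) :=
  ⟨fun i j => by simp [hA.apply_swap i j, hB.apply_swap i j, sub_eq_neg_add, add_comm],
    fun i => by simp [hA.apply_self i, hB.apply_self i]⟩

theorem conj [Fintype ι] {A : Matrix ι ι R} (hA : IsAlternating A) (X : Matrix ι κ R) :
    IsAlternating (Xᵀ * A * X) where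
  apply_swap i j := by
    rw [← Matrix.transpose_apply (Xᵀ * A * X) i j, Matrix.transpose_mul, Matrix.transpose_mul,
      hA.transpose_eq, Matrix.transpose_transpose, Matrix.neg_mul, Matrix.mul_neg,
      Matrix.mul_assoc, Matrix.neg_apply, neg_neg]
  apply_self i := by
    classical
    have e : (Xᵀ * A * X) i i = ∑ p : ι × ι, A p.1 p.2 * (X p.1 i * X p.2 i) := by
      simp only [Matrix.mul_apply, Finset.sum_mul, Matrix.transpose_apply, Fintype.sum_prod_type]
      rw [Finset.sum_comm]
      exact Finset.sum_congr rfl fun p _ => Finset.sum_congr rfl fun q _ => by ring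
    rw [e]
    -- Skew-symmetry alone says nothing about the diagonal in characteristic 2. The terms at `(p,
    -- q)` and `(q, p)` cancel, and the terms fixed by the swap vanish because `A` has zero
    -- diagonal.
    refine Finset.sum_involution (fun p _ => p.swap) ?_ ?_ (by simp) (by simp)
    · rintro ⟨p, q⟩ -
      simp only [Prod.fst_swap, Prod.snd_swap, hA.apply_swap q p]
      ring
    · rintro ⟨p, q⟩ - h h'
      obtain rfl : q = p := congrArg Prod.fst h'
      simp [hA.apply_self] at h

/-- Up to sign, `A⁻¹` is congruent to `A` via `A⁻¹` itself, so the zero diagonal comes for free from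
`conj`. -/
theorem inv [Fintype ι] [DecidableEq ι] {A : Matrix ι ι R} (hA : IsAlternating A)
    (h : IsUnit A.det) : IsAlternating A⁻¹ := by
  have h1 : A⁻¹ᵀ * A * A⁻¹ = -A⁻¹ := by
    rw [Matrix.mul_assoc, Matrix.mul_nonsing_inv _ h, Matrix.mul_one, Matrix.transpose_nonsing_inv,
      hA.transpose_eq]
    refine Matrix.inv_eq_left_inv ?_
    rw [Matrix.neg_mul, Matrix.mul_neg, neg_neg, Matrix.nonsing_inv_mul _ h]
  have h2 := (hA.conj A⁻¹).neg
  rwa [h1, neg_neg] at h2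

end IsAlternating

theorem isAlternating_alternatingMatrix {n : ℕ} (a : {p : Fin n × Fin n // p.1 < p.2} → R) :
    IsAlternating (alternatingMatrix a) where
  apply_swap i j := by
    simp only [alternatingMatrix, Matrix.of_apply]
    rcases lt_trichotomy i j with h | h | h
    · simp [h, h.not_gt]
    · simp [h]
    · simp [h, h.not_gt]
  apply_self i := by simp [alternatingMatrix]

theorem IsAlternating.alternatingMatrix_eq {n : ℕ} {A : Matrix (Fin n) (Fin n) R}
    (hA : IsAlternating A) : alternatingMatrix (fun p => A p.1.1 p.1.2) = A := by
  ext i j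
  simp only [alternatingMatrix, Matrix.of_apply]
  split_ifs with h h'
  · rfl
  · rw [hA.apply_swap i j]
  · obtain rfl : i = j := le_antisymm (not_lt.1 h') (not_lt.1 h)
    rw [hA.apply_self]

theorem map_alternatingMatrix {n : ℕ} (f : R →+* S) (a : {p : Fin n × Fin n // p.1 < p.2} → R) :
    (alternatingMatrix a).map f = alternatingMatrix (f ∘ a) := by
  ext i j
  simp only [alternatingMatrix, Matrix.of_apply, Matrix.map_apply]
  split_ifs <;> simp

theorem isAlternating_genericAlternating (n : ℕ) (R : Type u) [CommRing R] :
    IsAlternating (genericAlternating n R) :=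
  isAlternating_alternatingMatrix _

/-- Every alternating matrix is a specialization of the generic one. -/
theorem IsAlternating.exists_map_genericAlternating {n : ℕ} {A : Matrix (Fin n) (Fin n) R}
    (hA : IsAlternating A) :
    ∃ f : AltRing n ℤ →+* R, (genericAlternating n ℤ).map f = A := by
  refine ⟨MvPolynomial.eval₂Hom (Int.castRingHom R) fun p => A p.1.1 p.1.2, ?_⟩
  rw [genericAlternating, map_alternatingMatrix]
  convert hA.alternatingMatrix_eq using 2
  funext p
  simp

end alternating

/-! ### Symplectic bases over local rings -/

section symplecticBasis

theorem isAlternating_formMatrix (r : ℕ) (R : Type*) [CommRing R] :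
    IsAlternating (formMatrix r R) where
  apply_swap := formMatrix_apply_swap r R
  apply_self i := by rcases i with i | i <;> simp [formMatrix]

theorem conj_formMatrix_apply {R ι κ : Type*} [CommRing R] {r : ℕ}
    (X : Matrix (Fin r ⊕ Fin r) ι R) (Y : Matrix (Fin r ⊕ Fin r) κ R) (i : ι) (j : κ) :
    (Xᵀ * formMatrix r R * Y) i j =
      ∑ k, (X (.inl k) i * Y (.inr k.rev) j - X (.inr k.rev) i * Y (.inl k) j) := by
  have h : ∀ i j : Fin r, j = i.rev ↔ i = j.rev := fun i j => by rw [← Fin.rev_eq_iff, eq_comm]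
  simp only [formMatrix, Matrix.mul_apply, Matrix.transpose_apply, Fintype.sum_sum_type,
    Matrix.fromBlocks_apply₁₁, Matrix.fromBlocks_apply₁₂, Matrix.fromBlocks_apply₂₁,
    Matrix.fromBlocks_apply₂₂, antidiagonalMatrix, Matrix.of_apply, Matrix.neg_apply,
    Matrix.zero_apply]
  simp only [h, mul_zero, Finset.sum_const_zero, mul_neg, mul_ite, mul_one, zero_add, add_zero,
    Finset.sum_neg_distrib, Finset.sum_ite_eq', Finset.mem_univ, if_true]
  rw [Finset.sum_sub_distrib, ← Equiv.sum_comp Fin.revPerm fun x => X (.inl x.rev) i * Y (.inr x) j]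
  simp [sub_eq_neg_add, add_comm]

/-- Symplectic Gram–Schmidt: a unit entry `A p q` spans a hyperbolic plane; subtracting its rank two
form kills the rows and columns `p` and `q`, and induction handles the rest. Invertibility is
carried by an explicit right inverse `B` because the inverse of the remaining block is just the
corresponding block of `B`. -/
theorem exists_sum_eq_of_isLocalRing {R : Type*} [CommRing R] [IsLocalRing R] (m : ℕ) :
    ∀ {ι : Type*} [Fintype ι] [DecidableEq ι], Fintype.card ι = 2 * m → ∀ A B : Matrix ι ι R,
      IsAlternating A → A * B = 1 →
      ∃ u v : Fin m → ι → R, ∀ i j, A i j = ∑ k, (u k i * v k j - v k i * u k j) := by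
  induction m with
  | zero =>
    intro ι _ _ hc A B _ _
    have : IsEmpty ι := Fintype.card_eq_zero_iff.1 (by simpa using hc)
    exact ⟨fun _ => isEmptyElim, fun _ => isEmptyElim, isEmptyElim⟩
  | succ m ih =>
    intro ι _ _ hc A B hA hAB
    have : Nonempty ι := Fintype.card_pos_iff.1 (by omega)
    let p : ι := Classical.arbitrary ι
    -- If no entry of row `p` were a unit, that row would lie in the maximal ideal, and so would `(A
    -- * B) p p = 1`.
    obtain ⟨q, hq⟩ : ∃ q, IsUnit (A p q) := by
      by_contra! h
      have h1 : ∑ k, A p k * B k p = 1 := by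
        rw [← Matrix.mul_apply, hAB, Matrix.one_apply_eq]
      have h2 : (∑ k, A p k * B k p) ∈ IsLocalRing.maximalIdeal R :=
        Ideal.sum_mem _ fun k _ => Ideal.mul_mem_right _ _ (h k)
      rw [h1] at h2
      exact h2 isUnit_one
    obtain ⟨a, ha⟩ := hq
    have hpq : p ≠ q := by
      intro h
      rw [← h, hA.apply_self] at ha
      exact a.ne_zero ha
    -- Column `q`, scaled by the inverse of `A p q`, and row `p`: with this scaling the form `u₀ ∧
    -- v₀` agrees with `A` in the columns `p` and `q`.
    let u₀ : ι → R := fun i => A i q * ↑a⁻¹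
    let v₀ : ι → R := fun i => A p i
    let A' : Matrix ι ι R := fun i j => A i j - (u₀ i * v₀ j - v₀ i * u₀ j)
    have hup : u₀ p = 1 := by simp [u₀, ← ha]
    have huq : u₀ q = 0 := by simp [u₀, hA.apply_self]
    have hvp : v₀ p = 0 := hA.apply_self p
    have hvq : v₀ q = a := ha.symm
    have hA' : IsAlternating A' := by
      refine ⟨fun i j => ?_, fun i => ?_⟩
      · simp only [A', hA.apply_swap i j]; ring
      · simp only [A', hA.apply_self i]; ring
    have hA'p : ∀ i, A' i p = 0 := fun i => by
      simp only [A', hup, hvp, v₀, hA.apply_swap i p]; ring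
    have hA'q : ∀ i, A' i q = 0 := fun i => by
      simp only [A', huq, hvq, u₀]
      linear_combination (- A i q) * a.inv_mul
    let P : ι → Prop := fun i => i ≠ p ∧ i ≠ q
    have hcard : Fintype.card {i // P i} = 2 * m := by
      have h1 : Fintype.card {i // ¬ P i} = 2 := by
        rw [Fintype.card_subtype]
        have : (Finset.univ.filter fun i => ¬ P i) = {p, q} := by
          ext i; simp [P]; tauto
        rw [this, Finset.card_pair hpq]
      have h3 := Fintype.card_subtype_compl P
      have h4 : Fintype.card {i // P i} ≤ Fintype.card ι := Fintype.card_subtype_le P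
      omega
    have hsum : ∀ (f : ι → R), f p = 0 → f q = 0 → ∑ i : {i // P i}, f i = ∑ i, f i := by
      intro f h1 h2
      rw [← Finset.sum_subtype (Finset.univ.filter P) (by simp) f]
      refine Finset.sum_filter_of_ne fun i _ hi => ⟨?_, ?_⟩
      · rintro rfl; exact hi h1
      · rintro rfl; exact hi h2
    obtain ⟨u, v, huv⟩ := ih hcard (A'.submatrix Subtype.val Subtype.val)
      (B.submatrix Subtype.val Subtype.val) (hA'.submatrix _) (by
        ext i j
        rw [Matrix.mul_apply]
        simp only [Matrix.submatrix_apply]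
        -- The columns `p`, `q` of `A'` vanish, so the sum may run over all indices. There the
        -- correction terms drop out: `v₀` is row `p` of `A` and `u₀` a multiple of row `q`, and
        -- both are killed by the column `j` of `B` as `j ≠ p, q`.
        rw [hsum (fun k => A' i k * B k j) (by simp [hA'p]) (by simp [hA'q])]
        have e : ∀ i j, ∑ k, A i k * B k j = (1 : Matrix ι ι R) i j := fun i j => by
          rw [← hAB, Matrix.mul_apply]
        have h1 : ∑ k, v₀ k * B k j = 0 := by
          rw [e, Matrix.one_apply_ne j.2.1.symm]
        have h2 : ∑ k, u₀ k * B k j = 0 := by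
          have : ∀ k, u₀ k * B k j = -↑a⁻¹ * (A q k * B k j) := fun k => by
            simp only [u₀, hA.apply_swap k q]; ring
          rw [Finset.sum_congr rfl fun k _ => this k, ← Finset.mul_sum, e,
            Matrix.one_apply_ne j.2.2.symm, mul_zero]
        have h3 : ∀ k, A' i k * B k j =
            A i k * B k j - u₀ i * (v₀ k * B k j) + v₀ i * (u₀ k * B k j) := fun k => by
          simp only [A']; ring
        rw [Finset.sum_congr rfl fun k _ => h3 k, Finset.sum_add_distrib, Finset.sum_sub_distrib,
          ← Finset.mul_sum, ← Finset.mul_sum, h1, h2, e]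
        simp [Matrix.one_apply, Subtype.ext_iff])
    classical
    let extend (w : {i // P i} → R) (i : ι) : R := if h : P i then w ⟨i, h⟩ else 0
    refine ⟨Fin.cons u₀ fun k => extend (u k), Fin.cons v₀ fun k => extend (v k), fun i j => ?_⟩
    rw [Fin.sum_univ_succ]
    simp only [Fin.cons_zero, Fin.cons_succ]
    have h0 : A i j = (u₀ i * v₀ j - v₀ i * u₀ j) + A' i j := by simp only [A']; ring
    rw [h0]
    congr 1
    by_cases hi : P i
    · by_cases hj : P j
      · simpa [extend, hi, hj] using huv ⟨i, hi⟩ ⟨j, hj⟩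
      · have : A' i j = 0 := by
          have : j = p ∨ j = q := by simpa [P, or_iff_not_imp_left] using hj
          rcases this with rfl | rfl
          exacts [hA'p i, hA'q i]
        simp [extend, hj, this]
    · have : A' i j = 0 := by
        have : i = p ∨ i = q := by simpa [P, or_iff_not_imp_left] using hi
        rw [hA'.apply_swap]
        rcases this with rfl | rfl
        exacts [by rw [hA'p j, neg_zero], by rw [hA'q j, neg_zero]]
      simp [extend, hi, this]

/-- A nondegenerate alternating form over a local ring has a symplectic basis. -/
theorem IsAlternating.exists_conj_formMatrix_eq {R ι : Type*} [CommRing R] [IsLocalRing R]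
    [Fintype ι] [DecidableEq ι] {m : ℕ} (hc : Fintype.card ι = 2 * m) {A : Matrix ι ι R}
    (hA : IsAlternating A) (h : IsUnit A.det) :
    ∃ X : Matrix (Fin m ⊕ Fin m) ι R, Xᵀ * formMatrix m R * X = A := by
  obtain ⟨u, v, huv⟩ := exists_sum_eq_of_isLocalRing m hc A A⁻¹ hA (Matrix.mul_nonsing_inv _ h)
  -- The antidiagonal form pairs the left basis vector `k` with the right one `k.rev`, hence the
  -- reversal.
  refine ⟨Matrix.of (Sum.elim u fun k => v k.rev), ?_⟩
  ext i j
  rw [conj_formMatrix_apply, huv]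
  simp

end symplecticBasis

/-! ### The Pfaffian squares to the determinant -/

section pfaffian

/-- Expand multilinearly over the choices `g` of row indices of `X`. For fixed `g` the signed sum
over all `σ` is the determinant of `X` with rows selected by `g`; it vanishes when a row repeats,
and is `sign τ * X.det` when the selection is a permutation `τ`. Summing over all permutations, not
only the Pfaffian ones, is what makes a determinant appear. -/
theorem sum_pfaffianTerm_conj_square {R : Type*} [CommRing R] {m : ℕ}
    (M X : Matrix (Fin (2 * m)) (Fin (2 * m)) R) :
    ∑ σ, pfaffianTerm (Xᵀ * M * X) σ = X.det * ∑ σ, pfaffianTerm M σ := by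
  let F (g : Fin m → Fin (2 * m) × Fin (2 * m)) (a : Fin (2 * m)) : Fin (2 * m) :=
    bif ((pairIdx m).symm a).2 then (g ((pairIdx m).symm a).1).2 else (g ((pairIdx m).symm a).1).1
  have hFe : ∀ g i, F g (evenIdx i) = (g i).1 := fun g i => by
    simp only [F, ← pairIdx_false, Equiv.symm_apply_apply, cond_false]
  have hFo : ∀ g i, F g (oddIdx i) = (g i).2 := fun g i => by
    simp only [F, ← pairIdx_true, Equiv.symm_apply_apply, cond_true]
  have h1 : ∀ σ : Equiv.Perm (Fin (2 * m)), pfaffianTerm (Xᵀ * M * X) σ =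
      ∑ g : Fin m → Fin (2 * m) × Fin (2 * m), (∏ i, M (g i).1 (g i).2) *
        (((Equiv.Perm.sign σ : ℤ) : R) * ∏ a, X (F g a) (σ a)) := by
    intro σ
    have e : ∀ a b, (Xᵀ * M * X) a b =
        ∑ p : Fin (2 * m) × Fin (2 * m), M p.1 p.2 * (X p.1 a * X p.2 b) := by
      intro a b
      simp only [Matrix.mul_apply, Finset.sum_mul, Matrix.transpose_apply, Fintype.sum_prod_type]
      rw [Finset.sum_comm]
      exact Finset.sum_congr rfl fun p _ => Finset.sum_congr rfl fun q _ => by ring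
    simp only [pfaffianTerm, e]
    rw [Fintype.prod_sum, Finset.mul_sum]
    refine Finset.sum_congr rfl fun g _ => ?_
    rw [← Equiv.prod_comp (pairIdx m), Fintype.prod_prod_type]
    simp only [Fintype.prod_bool, pairIdx_true, pairIdx_false, hFe, hFo, Finset.prod_mul_distrib]
    ring
  have h2 : ∀ f : Fin (2 * m) → Fin (2 * m), ∑ σ : Equiv.Perm (Fin (2 * m)),
      ((Equiv.Perm.sign σ : ℤ) : R) * ∏ a, X (f a) (σ a) = (X.submatrix f id).det := by
    intro f
    rw [← Matrix.det_transpose, Matrix.det_apply']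
    rfl
  rw [Finset.sum_congr rfl fun σ _ => h1 σ, Finset.sum_comm]
  simp only [← Finset.mul_sum, h2]
  rw [Finset.mul_sum]
  symm
  refine Finset.sum_of_injOn (fun (τ : Equiv.Perm (Fin (2 * m))) i =>
    (τ (evenIdx i), τ (oddIdx i))) ?_ (fun _ _ => Finset.mem_coe.2 (Finset.mem_univ _)) ?_ ?_
  · intro τ _ τ' _ h
    ext1 a
    obtain ⟨⟨i, b⟩, rfl⟩ := (pairIdx m).surjective a
    have := congrFun h i
    cases b
    · exact congrArg Prod.fst this
    · exact congrArg Prod.snd this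
  · intro g _ hg
    have hinj : ¬ Function.Injective (F g) := by
      intro hinj
      refine hg ⟨Equiv.ofBijective _ (Finite.injective_iff_bijective.1 hinj),
        Finset.mem_coe.2 (Finset.mem_univ _), ?_⟩
      funext i
      exact Prod.ext (hFe g i) (hFo g i)
    simp only [Function.Injective, not_forall] at hinj
    obtain ⟨a, b, he, hab⟩ := hinj
    rw [Matrix.det_zero_of_row_eq hab, mul_zero]
    funext c
    simp [he]
  · intro τ _
    have hF : F (fun i => (τ (evenIdx i), τ (oddIdx i))) = τ := by
      funext a
      obtain ⟨⟨i, b⟩, rfl⟩ := (pairIdx m).surjective a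
      cases b
      · exact hFe (fun i => (τ (evenIdx i), τ (oddIdx i))) i
      · exact hFo (fun i => (τ (evenIdx i), τ (oddIdx i))) i
    rw [hF, Matrix.det_permute, pfaffianTerm]
    ring

/-- The sum over all permutations is `m! * 2 ^ m` times the Pfaffian; a domain of characteristic
zero allows this factor to be cancelled. -/
theorem pfaffian_conj {R : Type*} [CommRing R] [IsDomain R] [CharZero R] {m : ℕ}
    {M : Matrix (Fin (2 * m)) (Fin (2 * m)) R} (hM : IsAlternating M)
    (X : Matrix (Fin (2 * m)) (Fin (2 * m)) R) :
    pfaffian (Xᵀ * M * X) = X.det * pfaffian M := by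
  have h := sum_pfaffianTerm_conj_square M X
  rw [sum_pfaffianTerm M hM.apply_swap, sum_pfaffianTerm _ (hM.conj X).apply_swap,
    mul_left_comm] at h
  exact mul_left_cancel₀ (Nat.cast_ne_zero.2 Fintype.card_ne_zero) h

/-- The bijection of positions that sends the `i`-th pair to the `i`-th hyperbolic pair. -/
def hyperbolicIdx (m : ℕ) : Fin (2 * m) ≃ Fin m ⊕ Fin m :=
  (pairIdx m).symm.trans ((Equiv.prodComm _ _).trans
    ((Equiv.boolProdEquivSum (Fin m)).trans ((Equiv.refl _).sumCongr Fin.revPerm)))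

theorem hyperbolicIdx_evenIdx {m : ℕ} (i : Fin m) : hyperbolicIdx m (evenIdx i) = .inl i := by
  rw [hyperbolicIdx, ← pairIdx_false, Equiv.trans_apply, Equiv.symm_apply_apply]
  rfl

theorem hyperbolicIdx_oddIdx {m : ℕ} (i : Fin m) : hyperbolicIdx m (oddIdx i) = .inr i.rev := by
  rw [hyperbolicIdx, ← pairIdx_true, Equiv.trans_apply, Equiv.symm_apply_apply]
  rfl

/-- The induced map `τ` on pairs is strictly increasing because the first entries are, and a
strictly increasing self-map of `Fin m` is the identity. -/
theorem IsPfaffianPerm.eq_one {m : ℕ} {σ : Equiv.Perm (Fin (2 * m))} (hσ : IsPfaffianPerm σ)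
    {τ : Fin m → Fin m} (he : ∀ i, σ (evenIdx i) = evenIdx (τ i))
    (ho : ∀ i, σ (oddIdx i) = oddIdx (τ i)) : σ = 1 := by
  have hτ : StrictMono τ := fun i j hij => by
    have h : σ (evenIdx i) < σ (evenIdx j) := hσ.1 hij
    rw [he, he, Fin.lt_def] at h
    exact Fin.lt_def.2 (Nat.lt_of_mul_lt_mul_left h)
  have hid : τ = id := (hτ.range_inj strictMono_id).1 (by
    rw [Set.range_id, (Finite.injective_iff_surjective.1 hτ.injective).range_eq])
  subst hid
  ext1 a
  obtain ⟨⟨i, b⟩, rfl⟩ := (pairIdx m).surjective a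
  cases b
  · exact he i
  · exact ho i

/-- After reordering, a nonzero entry of the form joins the two members of one pair. A permutation
with nonzero contribution therefore permutes pairs, and the order conditions leave only the
identity. -/
theorem pfaffian_formMatrix (m : ℕ) (R : Type*) [CommRing R] :
    pfaffian ((formMatrix m R).submatrix (hyperbolicIdx m) (hyperbolicIdx m)) = 1 := by
  classical
  rw [pfaffian, Finset.sum_eq_single 1]
  · simp [hyperbolicIdx_evenIdx, hyperbolicIdx_oddIdx, formMatrix, antidiagonalMatrix]
  · intro σ hσ hne
    have hσ : IsPfaffianPerm σ := by simpa using hσ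
    by_contra h0
    have h1 : ∀ i, formMatrix m R (hyperbolicIdx m (σ (evenIdx i)))
        (hyperbolicIdx m (σ (oddIdx i))) ≠ 0 := fun i hi =>
      h0 (by rw [Finset.prod_eq_zero (Finset.mem_univ i) hi, mul_zero])
    have h2 : ∀ i, ∃ j, σ (evenIdx i) = evenIdx j ∧ σ (oddIdx i) = oddIdx j := by
      intro i
      obtain ⟨⟨a, b⟩, hab⟩ := (pairIdx m).surjective (σ (evenIdx i))
      obtain ⟨⟨c, d⟩, hcd⟩ := (pairIdx m).surjective (σ (oddIdx i))
      have h3 := h1 i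
      have h4 := hσ.2 i
      rw [← hab, ← hcd] at h3 h4 ⊢
      -- Two positions of equal parity give a zero entry. The order odd, even within one pair is
      -- excluded by `σ (evenIdx i) < σ (oddIdx i)`.
      cases b <;> cases d <;> simp only [pairIdx_true, pairIdx_false, hyperbolicIdx_evenIdx,
        hyperbolicIdx_oddIdx, formMatrix, antidiagonalMatrix, fromBlocks_apply₁₁,
        fromBlocks_apply₁₂, fromBlocks_apply₂₁, fromBlocks_apply₂₂, Matrix.neg_apply,
        Matrix.of_apply, Matrix.zero_apply, ne_eq, not_true_eq_false, neg_eq_zero,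
        ite_eq_right_iff, Fin.rev_rev, Fin.rev_inj, Classical.not_imp] at h3 h4 ⊢
      · exact ⟨c, by rw [h3.1], rfl⟩
      · rw [h3.1] at h4
        simp [evenIdx, oddIdx, Fin.lt_def] at h4
    choose τ he ho using h2
    exact hne (hσ.eq_one he ho)
  · intro h
    refine absurd (Finset.mem_filter.2 ⟨Finset.mem_univ _, ?_, fun i => ?_⟩) h
    · exact fun i j hij => Fin.lt_def.2 (Nat.mul_lt_mul_of_pos_left hij two_pos)
    · exact Fin.lt_def.2 (Nat.lt_succ_self _)

theorem det_formMatrix (m : ℕ) (R : Type*) [CommRing R] : (formMatrix m R).det = 1 := by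
  -- The block matrix with rows `(0, 1)` and `(-1, 0)` is a product of three unipotent ones, and the
  -- block diagonal factor contributes the determinant of the square of the antidiagonal matrix,
  -- which is `1`.
  have h1 : formMatrix m R =
      fromBlocks (antidiagonalMatrix m R) 0 0 (antidiagonalMatrix m R) *
        (fromBlocks 1 1 0 1 * fromBlocks 1 0 (-1) 1 * fromBlocks 1 1 0 1) := by
    simp [formMatrix, Matrix.fromBlocks_multiply]
  rw [h1, Matrix.det_mul, Matrix.det_mul, Matrix.det_mul, Matrix.det_fromBlocks_zero₂₁,
    Matrix.det_fromBlocks_zero₂₁, Matrix.det_fromBlocks_zero₁₂, ← Matrix.det_mul,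
    antidiagonalMatrix_mul_self]
  simp

theorem det_genericAlternating_ne_zero (m : ℕ) : (genericAlternating (2 * m) ℤ).det ≠ 0 := by
  intro h
  obtain ⟨f, hf⟩ :=
    ((isAlternating_formMatrix m ℤ).submatrix (hyperbolicIdx m)).exists_map_genericAlternating
  have := congrArg f h
  rw [RingHom.map_det, RingHom.mapMatrix_apply, hf, Matrix.det_submatrix_equiv_self,
    det_formMatrix, map_zero] at this
  exact one_ne_zero this

/-- Over the fraction field the generic matrix is congruent, by some `C`, to the standard form,
whose Pfaffian and determinant are `1`; both sides equal `C.det ^ 2`. -/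
theorem pfaffian_sq_genericAlternating (m : ℕ) :
    pfaffian (genericAlternating (2 * m) ℤ) ^ 2 = (genericAlternating (2 * m) ℤ).det := by
  let K := FractionRing (AltRing (2 * m) ℤ)
  have : CharZero K := charZero_of_injective_algebraMap (IsFractionRing.injective (AltRing (2 * m) ℤ) K)
  apply IsFractionRing.injective (AltRing (2 * m) ℤ) K
  rw [map_pow, map_pfaffian, RingHom.map_det, RingHom.mapMatrix_apply]
  set A := (genericAlternating (2 * m) ℤ).map (algebraMap (AltRing (2 * m) ℤ) K) with hA
  have hA0 : A.det ≠ 0 := by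
    rw [hA, ← RingHom.mapMatrix_apply, ← RingHom.map_det]
    exact (map_ne_zero_iff _ (IsFractionRing.injective (AltRing (2 * m) ℤ) K)).2
      (det_genericAlternating_ne_zero m)
  obtain ⟨X, hX⟩ := IsAlternating.exists_conj_formMatrix_eq (m := m) (by simp)
    ((isAlternating_genericAlternating (2 * m) ℤ).map (algebraMap _ K)) hA0.isUnit
  let C := X.submatrix (hyperbolicIdx m) id
  have hC : Cᵀ * (formMatrix m K).submatrix (hyperbolicIdx m) (hyperbolicIdx m) * C = A := by
    rw [hA, ← hX, Matrix.transpose_submatrix, Matrix.submatrix_mul_equiv,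
      Matrix.submatrix_mul_equiv, Matrix.submatrix_id_id]
  rw [← hC, pfaffian_conj ((isAlternating_formMatrix m K).submatrix _), pfaffian_formMatrix,
    Matrix.det_mul, Matrix.det_mul, Matrix.det_transpose, Matrix.det_submatrix_equiv_self,
    det_formMatrix]
  ring

/-- The square of the Pfaffian of an alternating matrix is its determinant. -/
theorem IsAlternating.pfaffian_sq {R : Type*} [CommRing R] {m : ℕ}
    {A : Matrix (Fin (2 * m)) (Fin (2 * m)) R} (hA : IsAlternating A) :
    pfaffian A ^ 2 = A.det := by
  obtain ⟨f, rfl⟩ := hA.exists_map_genericAlternating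
  rw [← map_pfaffian, ← map_pow, pfaffian_sq_genericAlternating, RingHom.map_det,
    RingHom.mapMatrix_apply]

end pfaffian

/-! ### Alternating matrices with vanishing Pfaffians -/

section schur

theorem det_genericAlternating_submatrix_ne_zero {n r : ℕ} (e : Fin (2 * r) ↪o Fin n) :
    ((genericAlternating n ℤ).submatrix e e).det ≠ 0 := by
  intro h
  -- The coordinate projection onto `e`: pulling back along it puts the standard form on `e` and
  -- zeros elsewhere, a specialization in which the minor equals `1`.
  let X : Matrix (Fin (2 * r)) (Fin n) ℤ := fun a i => if e a = i then 1 else 0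
  have hX : X.submatrix id e = 1 := by
    ext a b
    rw [Matrix.submatrix_apply]
    simp [X, Matrix.one_apply]
  let S := (formMatrix r ℤ).submatrix (hyperbolicIdx r) (hyperbolicIdx r)
  obtain ⟨f, hf⟩ := (((isAlternating_formMatrix r ℤ).submatrix
    (hyperbolicIdx r)).conj X).exists_map_genericAlternating
  have h1 : (Xᵀ * S * X).submatrix e e = S := by
    calc (Xᵀ * S * X).submatrix e e = (X.submatrix id e)ᵀ * S * X.submatrix id e := rfl
      _ = S := by rw [hX, Matrix.transpose_one, Matrix.one_mul, Matrix.mul_one]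
  have := congrArg f h
  rw [RingHom.map_det, RingHom.mapMatrix_apply, ← Matrix.submatrix_map, hf, h1,
    Matrix.det_submatrix_equiv_self, det_formMatrix, map_zero] at this
  exact one_ne_zero this

variable {R : Type*} [CommRing R]

/-- The determinant of the principal submatrix on `e`, times the Schur complement with respect
to it. -/
def scaledSchur {n m : ℕ} (A : Matrix (Fin n) (Fin n) R) (e : Fin m → Fin n) :
    Matrix (Fin n) (Fin n) R :=
  (A.submatrix e e).det • A -
    A.submatrix id e * (A.submatrix e e).adjugate * A.submatrix e id

/-- The adjugate makes the scaled Schur complement polynomial in the entries, so that identities for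
the generic matrix pass to every ring. -/
theorem map_scaledSchur {S : Type*} [CommRing S] (f : R →+* S) {n m : ℕ}
    (A : Matrix (Fin n) (Fin n) R) (e : Fin m → Fin n) :
    (scaledSchur A e).map f = scaledSchur (A.map f) e := by
  have h1 := f.map_adjugate (A.submatrix e e)
  have h2 := f.map_det (A.submatrix e e)
  simp only [RingHom.mapMatrix_apply] at h1 h2
  rw [scaledSchur, scaledSchur, Matrix.map_sub _ (map_sub f), Matrix.map_mul, Matrix.map_mul, h1]
  congr 1
  ext i j
  simp [h2, ← Matrix.submatrix_map]

theorem scaledSchur_apply {n m : ℕ} {A : Matrix (Fin n) (Fin n) R} {e : Fin m → Fin n}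
    (hu : IsUnit (A.submatrix e e).det) (i j : Fin n) :
    scaledSchur A e i j = (A.submatrix e e).det *
      (A - A.submatrix id e * (A.submatrix e e)⁻¹ * A.submatrix e id) i j := by
  have h : scaledSchur A e = (A.submatrix e e).det •
      (A - A.submatrix id e * (A.submatrix e e)⁻¹ * A.submatrix e id) := by
    rw [scaledSchur, smul_sub, Matrix.inv_def, Matrix.mul_smul, Matrix.smul_mul, smul_smul,
      Ring.mul_inverse_cancel _ hu, one_smul]
  rw [h, Matrix.smul_apply, smul_eq_mul]

theorem IsAlternating.schur {n m : ℕ} {A : Matrix (Fin n) (Fin n) R} (hA : IsAlternating A)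
    {e : Fin m → Fin n} (hu : IsUnit (A.submatrix e e).det) :
    IsAlternating (A - A.submatrix id e * (A.submatrix e e)⁻¹ * A.submatrix e id) := by
  have h1 : A.submatrix id e = -(A.submatrix e id)ᵀ := by
    ext i j
    exact hA.apply_swap _ _
  rw [h1, Matrix.neg_mul, Matrix.neg_mul]
  exact hA.sub (((hA.submatrix e).inv hu).conj _).neg

/-- Schur's determinant formula: the complement is a `2 × 2` alternating block, whose determinant is
the square of its off-diagonal entry. -/
theorem IsAlternating.det_submatrix_sumElim {n m : ℕ} {A : Matrix (Fin n) (Fin n) R}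
    (hA : IsAlternating A) {e : Fin m → Fin n} (hu : IsUnit (A.submatrix e e).det) (i j : Fin n) :
    (A.submatrix (Sum.elim e ![i, j]) (Sum.elim e ![i, j])).det =
      (A.submatrix e e).det *
        (A - A.submatrix id e * (A.submatrix e e)⁻¹ * A.submatrix e id) i j ^ 2 := by
  have hs := hA.schur hu
  set S := A - A.submatrix id e * (A.submatrix e e)⁻¹ * A.submatrix e id with hS
  have h1 : A.submatrix (Sum.elim e ![i, j]) (Sum.elim e ![i, j]) =
      fromBlocks (A.submatrix e e) (A.submatrix e ![i, j]) (A.submatrix ![i, j] e)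
        (A.submatrix ![i, j] ![i, j]) := by
    ext (a | a) (b | b) <;> rfl
  let _ := (A.submatrix e e).invertibleOfIsUnitDet hu
  have h2 : A.submatrix ![i, j] ![i, j] - A.submatrix ![i, j] e * ⅟(A.submatrix e e) *
      A.submatrix e ![i, j] = S.submatrix ![i, j] ![i, j] := by
    rw [Matrix.invOf_eq_nonsing_inv]
    rfl
  rw [h1, Matrix.det_fromBlocks₁₁, h2, Matrix.det_fin_two]
  simp only [Matrix.submatrix_apply, Matrix.cons_val_zero, Matrix.cons_val_one, hs.apply_self,
    hs.apply_swap j i]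
  ring

/-- The Pfaffian ideal only involves increasing index tuples, so `e` followed by `i, j` has to be
sorted. The separate `N` allows the size `2 * (r + 1)` without a cast. -/
theorem exists_orderEmbedding_sumElim {n m : ℕ} (e : Fin m ↪o Fin n) {i j : Fin n}
    (hi : i ∉ Set.range e) (hj : j ∉ Set.range e) (hij : i ≠ j) {N : ℕ} (hN : N = m + 2) :
    ∃ (e' : Fin N ↪o Fin n) (φ : Fin N ≃ Fin m ⊕ Fin 2), Sum.elim e ![i, j] ∘ φ = e' := by
  have hw : Function.Injective (Sum.elim e ![i, j]) := by
    refine Function.Injective.sumElim e.injective ?_ ?_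
    · intro a b h
      fin_cases a <;> fin_cases b <;> simp_all
    · intro a b h
      fin_cases b
      · exact hi ⟨a, h⟩
      · exact hj ⟨a, h⟩
  let T : Finset (Fin n) := Finset.univ.map ⟨_, hw⟩
  have hT : T.card = N := by simp [T, hN]
  let e' := T.orderEmbOfFin hT
  have hr : Set.range e' = Set.range (Sum.elim e ![i, j]) := by
    rw [Finset.range_orderEmbOfFin]
    simp [T]
  refine ⟨e', ((Equiv.ofInjective _ e'.injective).trans (Equiv.setCongr hr)).trans
    (Equiv.ofInjective _ hw).symm, ?_⟩
  funext a
  exact Equiv.apply_ofInjective_symm hw _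

/-- The squares of the two sides agree by `pfaffian_sq` and Schur's formula. For the generic matrix
they live in a domain, so the sides agree up to sign. The sign is left open, since only the
vanishing of one side matters later. -/
theorem IsAlternating.det_mul_pfaffian_eq_or {n r : ℕ} {A : Matrix (Fin n) (Fin n) R}
    (hA : IsAlternating A) (e : Fin (2 * r) ↪o Fin n) {i j : Fin n}
    {e' : Fin (2 * (r + 1)) ↪o Fin n} {φ : Fin (2 * (r + 1)) ≃ Fin (2 * r) ⊕ Fin 2}
    (hφ : Sum.elim e ![i, j] ∘ φ = e') :
    (A.submatrix e e).det * pfaffian (A.submatrix e' e') =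
        pfaffian (A.submatrix e e) * scaledSchur A e i j ∨
      (A.submatrix e e).det * pfaffian (A.submatrix e' e') =
        -(pfaffian (A.submatrix e e) * scaledSchur A e i j) := by
  obtain ⟨f, rfl⟩ := hA.exists_map_genericAlternating
  let K := FractionRing (AltRing n ℤ)
  let ψ := algebraMap (AltRing n ℤ) K
  have hψ : Function.Injective ψ := IsFractionRing.injective (AltRing n ℤ) K
  set A := genericAlternating n ℤ
  have hA : IsAlternating (A.map ψ) := (isAlternating_genericAlternating n ℤ).map ψ
  have hu : IsUnit ((A.map ψ).submatrix e e).det := by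
    rw [Matrix.submatrix_map, ← RingHom.mapMatrix_apply, ← RingHom.map_det]
    exact ((map_ne_zero_iff _ hψ).2 (det_genericAlternating_submatrix_ne_zero e)).isUnit
  have key : ((A.submatrix e e).det * pfaffian (A.submatrix e' e')) ^ 2 =
      (pfaffian (A.submatrix e e) * scaledSchur A e i j) ^ 2 := by
    apply hψ
    have h1 : ψ (scaledSchur A e i j) = scaledSchur (A.map ψ) e i j := by
      rw [← map_scaledSchur, Matrix.map_apply]
    simp only [map_pow, map_mul, map_pfaffian, RingHom.map_det, RingHom.mapMatrix_apply,
      ← Matrix.submatrix_map, mul_pow, h1, scaledSchur_apply hu]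
    rw [(hA.submatrix e).pfaffian_sq, (hA.submatrix e').pfaffian_sq, ← hφ,
      ← Matrix.submatrix_submatrix, Matrix.det_submatrix_equiv_self,
      hA.det_submatrix_sumElim hu]
    ring
  have h1 : f (scaledSchur A e i j) = scaledSchur (A.map f) e i j := by
    rw [← map_scaledSchur, Matrix.map_apply]
  have h2 : f (A.submatrix e e).det = ((A.map f).submatrix e e).det := by
    rw [RingHom.map_det, RingHom.mapMatrix_apply, ← Matrix.submatrix_map]
  have h3 : f (pfaffian (A.submatrix e e)) = pfaffian ((A.map f).submatrix e e) := by
    rw [map_pfaffian, ← Matrix.submatrix_map]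
  have h4 : f (pfaffian (A.submatrix e' e')) = pfaffian ((A.map f).submatrix e' e') := by
    rw [map_pfaffian, ← Matrix.submatrix_map]
  rw [← h1, ← h2, ← h3, ← h4, ← map_mul, ← map_mul, ← map_neg]
  exact (sq_eq_sq_iff_eq_or_eq_neg.1 key).imp (congrArg f) (congrArg f)

theorem IsAlternating.isUnit_det_iff {m : ℕ} {A : Matrix (Fin (2 * m)) (Fin (2 * m)) R}
    (hA : IsAlternating A) : IsUnit A.det ↔ IsUnit (pfaffian A) := by
  rw [← hA.pfaffian_sq, isUnit_pow_iff two_ne_zero]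

/-- An alternating matrix whose Pfaffians of size `2r + 2` vanish is determined by the rows of a
main submatrix of size `2r` with invertible Pfaffian. -/
theorem IsAlternating.eq_mul_inv_mul {n r : ℕ} {A : Matrix (Fin n) (Fin n) R}
    (hA : IsAlternating A) {e : Fin (2 * r) ↪o Fin n}
    (hu : IsUnit (pfaffian (A.submatrix e e)))
    (h0 : ∀ e' : Fin (2 * (r + 1)) ↪o Fin n, pfaffian (A.submatrix e' e') = 0) :
    A.submatrix id e * (A.submatrix e e)⁻¹ * A.submatrix e id = A := by
  have hd : IsUnit (A.submatrix e e).det := (hA.submatrix e).isUnit_det_iff.2 hu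
  have hs := hA.schur hd
  rw [eq_comm, ← sub_eq_zero]
  set S := A - A.submatrix id e * (A.submatrix e e)⁻¹ * A.submatrix e id with hS
  have hrow : ∀ a j, S (e a) j = 0 := by
    intro a j
    have : S.submatrix e id = 0 := by
      calc S.submatrix e id = A.submatrix e id -
          A.submatrix e e * (A.submatrix e e)⁻¹ * A.submatrix e id := rfl
        _ = 0 := by rw [Matrix.mul_nonsing_inv _ hd, Matrix.one_mul, sub_self]
    exact congrFun (congrFun this a) j
  ext i j
  by_cases hi : i ∈ Set.range e
  · obtain ⟨a, rfl⟩ := hi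
    exact hrow a j
  by_cases hj : j ∈ Set.range e
  · obtain ⟨a, rfl⟩ := hj
    rw [hs.apply_swap, hrow, neg_zero, Matrix.zero_apply]
  by_cases hij : i = j
  · subst hij
    exact hs.apply_self i
  -- The other entries of the Schur complement vanish by elimination and alternation; only distinct
  -- `i`, `j` outside `e` need a Pfaffian of size `2r + 2`.
  obtain ⟨e', φ, hφ⟩ := exists_orderEmbedding_sumElim e hi hj hij (N := 2 * (r + 1)) (by ring)
  have h1 : pfaffian (A.submatrix e e) * scaledSchur A e i j = 0 := by
    rcases hA.det_mul_pfaffian_eq_or e hφ with h | h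
    · rw [← h, h0, mul_zero]
    · rw [← neg_eq_zero, ← h, h0, mul_zero]
  rw [hu.mul_right_eq_zero, scaledSchur_apply hd, hd.mul_right_eq_zero] at h1
  exact h1

end schur

/-! ### Rank -/

section rank

variable {F : Type*} [Field F]

theorem exists_eq_mul_submatrix {n d : ℕ} {A : Matrix (Fin n) (Fin n) F} (hd : A.rank = d) :
    ∃ (e : Fin d ↪o Fin n) (L : Matrix (Fin n) (Fin d) F), A = L * A.submatrix e id := by
  rw [Matrix.rank_eq_finrank_span_row] at hd
  -- A basis of the row space can be chosen among the rows; its indices are sorted below to obtain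
  -- an order embedding.
  obtain ⟨f, hf, hspan, hli⟩ := Submodule.exists_fun_fin_finrank_span_eq F (Set.range A.row)
  choose c hc using hf
  have hinj : Function.Injective c := fun i j h => hli.injective (by rw [← hc, ← hc, h])
  let T : Finset (Fin n) := Finset.univ.map ⟨c, hinj⟩
  have hT : T.card = d := by simp [T, hd]
  have hr : Set.range (T.orderEmbOfFin hT) = Set.range c := by
    rw [Finset.range_orderEmbOfFin]
    simp [T]
  have hmem : ∀ i, ∃ l : Fin d → F, ∑ a, l a • A.row (T.orderEmbOfFin hT a) = A.row i := by
    intro i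
    have h1 : A.row i ∈ Submodule.span F (Set.range fun a => A.row (T.orderEmbOfFin hT a)) := by
      have h2 : (Set.range fun a => A.row (T.orderEmbOfFin hT a)) = Set.range f := by
        rw [← funext hc]
        change Set.range (A.row ∘ T.orderEmbOfFin hT) = Set.range (A.row ∘ c)
        rw [Set.range_comp, hr, Set.range_comp]
      rw [h2, hspan]
      exact Submodule.subset_span ⟨i, rfl⟩
    exact (Submodule.mem_span_range_iff_exists_fun F).1 h1
  choose L hL using hmem
  refine ⟨T.orderEmbOfFin hT, L, ?_⟩
  ext i j
  have := congrFun (hL i) j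
  rw [Finset.sum_apply] at this
  exact this.symm

/-- By skew-symmetry, rows `e` spanning the row space also serve as columns: `A = L A_{e·}`
transposes to `A_{e·} = A_ee ᵗL`, so `A = L A_ee ᵗL` and `A_ee` has full rank `d`. -/
theorem IsAlternating.exists_isUnit_det {n d : ℕ} {A : Matrix (Fin n) (Fin n) F}
    (hA : IsAlternating A) (hd : A.rank = d) :
    ∃ e : Fin d ↪o Fin n, IsUnit (A.submatrix e e).det := by
  obtain ⟨e, L, h⟩ := exists_eq_mul_submatrix hd
  refine ⟨e, ?_⟩
  have h1 : A = L * (A.submatrix e e * Lᵀ) := by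
    have h2 : A.submatrix id e = L * A.submatrix e e := congrArg (fun B => B.submatrix id e) h
    have h3 : A.submatrix e id = -(A.submatrix id e)ᵀ := by
      ext i j
      exact hA.apply_swap _ _
    rw [h2, Matrix.transpose_mul, (hA.submatrix e).transpose_eq, Matrix.neg_mul, neg_neg] at h3
    rwa [h3] at h
  have h2 : d ≤ (A.submatrix e e).rank := by
    refine (hd.symm.trans (congrArg Matrix.rank h1)).le.trans ?_
    exact (Matrix.rank_mul_le_right _ _).trans (Matrix.rank_mul_le_left _ _)
  have h3 := Matrix.rank_le_card_height (A.submatrix e e)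
  rw [Fintype.card_fin] at h3
  rw [← Matrix.isUnit_iff_isUnit_det, ← Matrix.mulVec_surjective_iff_isUnit]
  exact LinearMap.range_eq_top.1 (Submodule.eq_top_of_finrank_eq
    (S := LinearMap.range (A.submatrix e e).mulVecLin) (by
      rw [Module.finrank_fin_fun]
      exact le_antisymm h3 h2))

/-- A nonzero Pfaffian bounds the rank below by its size. The upper bound in the converse comes from
the factorization of `A` through a `2r`-dimensional space in `IsAlternating.eq_mul_inv_mul`; no
larger Pfaffians are needed. -/
theorem IsAlternating.rank_eq_iff {n r : ℕ} {A : Matrix (Fin n) (Fin n) F}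
    (hA : IsAlternating A) : A.rank = 2 * r ↔
      (∀ e : Fin (2 * (r + 1)) ↪o Fin n, pfaffian (A.submatrix e e) = 0) ∧
        ∃ e : Fin (2 * r) ↪o Fin n, pfaffian (A.submatrix e e) ≠ 0 := by
  constructor
  · intro h
    refine ⟨fun e => ?_, ?_⟩
    · by_contra h0
      have h1 : IsUnit (A.submatrix e e).det := (hA.submatrix e).isUnit_det_iff.2 (Ne.isUnit h0)
      have h2 := Matrix.rank_of_isUnit _ ((Matrix.isUnit_iff_isUnit_det _).2 h1)
      have h3 := Matrix.rank_submatrix_le A e e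
      rw [h2, h, Fintype.card_fin] at h3
      omega
    · obtain ⟨e, he⟩ := hA.exists_isUnit_det h
      exact ⟨e, ((hA.submatrix e).isUnit_det_iff.1 he).ne_zero⟩
  · rintro ⟨h0, e, he⟩
    have hd : IsUnit (A.submatrix e e).det := (hA.submatrix e).isUnit_det_iff.2 (Ne.isUnit he)
    apply le_antisymm
    · rw [← hA.eq_mul_inv_mul (Ne.isUnit he) h0]
      exact (Matrix.rank_mul_le_right _ _).trans ((Matrix.rank_le_card_height _).trans (by simp))
    · have h2 := Matrix.rank_of_isUnit _ ((Matrix.isUnit_iff_isUnit_det _).2 hd)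
      have h3 := Matrix.rank_submatrix_le A e e
      rwa [h2, Fintype.card_fin] at h3

end rank

/-! ### Symplectic matrices relating two maps with the same pulled back form -/

section torsor

variable {R : Type*} [CommRing R] {n r : ℕ}

/-- A map `X : R^n → R^{2r}` is determined up to a unique symplectic matrix by the form it pulls
back, if that form is nondegenerate on a coordinate subspace of dimension `2r`. -/
theorem existsUnique_symplectic {X Y : Matrix (Fin r ⊕ Fin r) (Fin n) R}
    (hXY : Xᵀ * formMatrix r R * X = Yᵀ * formMatrix r R * Y) {e : Fin (2 * r) → Fin n}
    (hu : IsUnit ((Yᵀ * formMatrix r R * Y).submatrix e e).det) :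
    ∃! g : Matrix (Fin r ⊕ Fin r) (Fin r ⊕ Fin r) R,
      gᵀ * formMatrix r R * g = formMatrix r R ∧ g * Y = X := by
  set J := formMatrix r R with hJ
  -- Reindexing `e` by the hyperbolic positions makes the selected column blocks square matrices on
  -- `Fin r ⊕ Fin r`, so that determinants and inverses make sense.
  let c : Fin r ⊕ Fin r → Fin n := e ∘ (hyperbolicIdx r).symm
  have hdet : ∀ Z : Matrix (Fin r ⊕ Fin r) (Fin n) R, Zᵀ * J * Z = Yᵀ * J * Y →
      IsUnit (Z.submatrix id c).det := by
    intro Z hZ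
    have h1 : ((Z.submatrix id c)ᵀ * J * Z.submatrix id c).det =
        ((Yᵀ * J * Y).submatrix e e).det := by
      rw [← hZ, ← Matrix.det_submatrix_equiv_self (hyperbolicIdx r).symm]
      rfl
    rw [← h1, Matrix.det_mul] at hu
    exact isUnit_of_mul_isUnit_right hu
  have hX := hdet X hXY
  have hY := hdet Y rfl
  set Xc := X.submatrix id c
  set Yc := Y.submatrix id c
  have hc : Xcᵀ * J * Xc = Ycᵀ * J * Yc := congrArg (fun B => B.submatrix c c) hXY
  have hr : Xcᵀ * J * X = Ycᵀ * J * Y := congrArg (fun B => B.submatrix c id) hXY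
  have hinv : IsUnit (Xcᵀ * J).det := by
    rw [Matrix.det_mul, Matrix.det_transpose, hJ, det_formMatrix, mul_one]
    exact hX
  refine ⟨Xc * Yc⁻¹, ⟨?_, ?_⟩, ?_⟩
  · calc (Xc * Yc⁻¹)ᵀ * J * (Xc * Yc⁻¹) = Yc⁻¹ᵀ * (Xcᵀ * J * Xc) * Yc⁻¹ := by
          simp only [Matrix.transpose_mul, Matrix.mul_assoc]
      _ = (Yc * Yc⁻¹)ᵀ * J * (Yc * Yc⁻¹) := by
          rw [hc]
          simp only [Matrix.transpose_mul, Matrix.mul_assoc]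
      _ = J := by
          rw [Matrix.mul_nonsing_inv _ hY, Matrix.transpose_one, Matrix.one_mul, Matrix.mul_one]
  · have h1 : Xcᵀ * J * (Xc * Yc⁻¹ * Y) = Xcᵀ * J * X := by
      calc Xcᵀ * J * (Xc * Yc⁻¹ * Y) = (Xcᵀ * J * Xc) * Yc⁻¹ * Y := by
            simp only [Matrix.mul_assoc]
        _ = Ycᵀ * J * (Yc * Yc⁻¹) * Y := by
            rw [hc]
            simp only [Matrix.mul_assoc]
        _ = _ := by rw [Matrix.mul_nonsing_inv _ hY, Matrix.mul_one, hr]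
    have h2 := congrArg (fun B => (Xcᵀ * J)⁻¹ * B) h1
    simpa only [← Matrix.mul_assoc, Matrix.nonsing_inv_mul _ hinv, Matrix.one_mul] using h2
  · rintro g ⟨-, hg⟩
    have h1 : g * Yc = Xc := congrArg (fun B => B.submatrix id c) hg
    rw [← h1, Matrix.mul_assoc, Matrix.mul_nonsing_inv _ hY, Matrix.mul_one]

/-- Over a local ring, an alternating matrix of constant rank `2r` is pulled back from the
standard symplectic form. -/
theorem IsAlternating.exists_conj_formMatrix_eq_of_pfaffian [IsLocalRing R]
    {A : Matrix (Fin n) (Fin n) R} (hA : IsAlternating A) {e : Fin (2 * r) ↪o Fin n}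
    (hu : IsUnit (pfaffian (A.submatrix e e)))
    (h0 : ∀ e' : Fin (2 * (r + 1)) ↪o Fin n, pfaffian (A.submatrix e' e') = 0) :
    ∃ X : Matrix (Fin r ⊕ Fin r) (Fin n) R, Xᵀ * formMatrix r R * X = A := by
  have hAe := hA.submatrix e
  have hd : IsUnit (A.submatrix e e).det := hAe.isUnit_det_iff.2 hu
  obtain ⟨C, hC⟩ := hAe.exists_conj_formMatrix_eq (m := r) (by simp) hd
  -- This matrix pulls the standard form back to `A_{·e} A_ee⁻¹ A_{e·}`, which is `A` as the Schur
  -- complement vanishes.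
  refine ⟨C * (A.submatrix e e)⁻¹ * A.submatrix e id, ?_⟩
  have h1 : (A.submatrix e id)ᵀ = -A.submatrix id e := by
    ext i j
    exact hA.apply_swap _ _
  calc (C * (A.submatrix e e)⁻¹ * A.submatrix e id)ᵀ * formMatrix r R *
        (C * (A.submatrix e e)⁻¹ * A.submatrix e id) =
      (A.submatrix e id)ᵀ * (A.submatrix e e)⁻¹ᵀ * (Cᵀ * formMatrix r R * C) *
        (A.submatrix e e)⁻¹ * A.submatrix e id := by
        simp only [Matrix.transpose_mul, Matrix.mul_assoc]
    _ = A.submatrix id e * ((A.submatrix e e)⁻¹ * A.submatrix e e) * (A.submatrix e e)⁻¹ *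
        A.submatrix e id := by
        rw [hC, h1, (hAe.inv hd).transpose_eq, Matrix.neg_mul, Matrix.mul_neg, neg_neg]
        simp only [Matrix.mul_assoc]
    _ = A := by
        rw [Matrix.nonsing_inv_mul _ hd, Matrix.mul_one, hA.eq_mul_inv_mul hu h0]

end torsor

/-! ### Points of the coordinate rings -/

section points

variable {r n s : ℕ} {k : Type u} [CommRing k] {B : Type*} [CommRing B] [Algebra k B]

/-- The matrix of a `B`-point of `Hom(V, E)`. -/
def homMatrix (x : HomRing r n k →ₐ[k] B) : Matrix (Fin r ⊕ Fin r) (Fin n) B :=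
  (genericMatrix (Fin r ⊕ Fin r) (Fin n) k).map x

/-- The matrix of a `B`-point of the symplectic group. -/
def symplecticMatrix (g : SymplecticRing r k →ₐ[k] B) :
    Matrix (Fin r ⊕ Fin r) (Fin r ⊕ Fin r) B :=
  (SymplecticRing.generic r k).map g

/-- The alternating matrix of a `B`-point of the Pfaffian scheme. -/
def pfaffianMatrix (a : PfaffianRing n s k →ₐ[k] B) : Matrix (Fin n) (Fin n) B :=
  (PfaffianRing.generic n s k).map a

theorem homMatrix_injective :
    Function.Injective (homMatrix : (HomRing r n k →ₐ[k] B) → Matrix _ _ B) :=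
  fun _ _ h => HomRing.algHom_ext h

theorem exists_homMatrix_eq (X : Matrix (Fin r ⊕ Fin r) (Fin n) B) :
    ∃ x : HomRing r n k →ₐ[k] B, homMatrix x = X :=
  ⟨MvPolynomial.aeval fun p => X p.1 p.2, map_genericMatrix_aeval X⟩

theorem symplecticMatrix_injective :
    Function.Injective (symplecticMatrix : (SymplecticRing r k →ₐ[k] B) → Matrix _ _ B) :=
  fun _ _ h => SymplecticRing.algHom_ext h

theorem symplecticMatrix_rel (g : SymplecticRing r k →ₐ[k] B) :
    (symplecticMatrix g)ᵀ * formMatrix r B * symplecticMatrix g = formMatrix r B :=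
  SymplecticRing.map_generic_rel g

theorem exists_symplecticMatrix_eq {g : Matrix (Fin r ⊕ Fin r) (Fin r ⊕ Fin r) B}
    (hg : gᵀ * formMatrix r B * g = formMatrix r B) :
    ∃ γ : SymplecticRing r k →ₐ[k] B, symplecticMatrix γ = g :=
  ⟨SymplecticRing.lift g hg, SymplecticRing.lift_generic g hg⟩

theorem pfaffianMatrix_injective :
    Function.Injective (pfaffianMatrix : (PfaffianRing n s k →ₐ[k] B) → Matrix _ _ B) := by
  intro f g h
  refine Ideal.Quotient.algHom_ext _ (MvPolynomial.algHom_ext fun p => ?_)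
  have := congrFun (congrFun h p.1.1) p.1.2
  simp only [pfaffianMatrix, PfaffianRing.generic, Matrix.map_apply, genericAlternating,
    alternatingMatrix, Matrix.of_apply, dif_pos p.2] at this
  exact this

theorem isAlternating_pfaffianMatrix (a : PfaffianRing n s k →ₐ[k] B) :
    IsAlternating (pfaffianMatrix a) :=
  ((isAlternating_genericAlternating n k).map (PfaffianRing.mk n s k).toRingHom).map a.toRingHom

theorem pfaffian_pfaffianMatrix (a : PfaffianRing n s k →ₐ[k] B) {m : ℕ}
    (e : Fin (2 * m) → Fin n) :
    pfaffian ((pfaffianMatrix a).submatrix e e) =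
      a (PfaffianRing.mk n s k (pfaffian ((genericAlternating n k).submatrix e e))) := by
  have h := map_pfaffian (a.comp (PfaffianRing.mk n s k)).toRingHom
    ((genericAlternating n k).submatrix e e)
  exact h.symm

theorem pfaffian_pfaffianMatrix_eq_zero (a : PfaffianRing n s k →ₐ[k] B)
    (e : Fin (2 * s) ↪o Fin n) : pfaffian ((pfaffianMatrix a).submatrix e e) = 0 := by
  rw [pfaffian_pfaffianMatrix]
  have : PfaffianRing.mk n s k (pfaffian ((genericAlternating n k).submatrix e e)) = 0 :=
    Ideal.Quotient.eq_zero_iff_mem.2 (Ideal.subset_span ⟨e, rfl⟩)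
  rw [this, map_zero]

theorem pfaffianMatrix_comp_coquotient (h : r < s) (x : HomRing r n k →ₐ[k] B) :
    pfaffianMatrix (x.comp (coquotient r n k s h)) =
      (homMatrix x)ᵀ * formMatrix r B * homMatrix x := by
  have h1 : pfaffianMatrix (x.comp (coquotient r n k s h)) = (pulledBackForm r n k).map x := by
    rw [← map_genericAlternating_coquotientAux]
    rfl
  rw [h1, pulledBackForm, Matrix.map_mul, Matrix.map_mul, Matrix.transpose_map, map_formMatrix]
  rfl

/-- The section of the quotient morphism over a local ring. -/
theorem exists_comp_coquotient_eq [IsLocalRing B] (h : r < r + 1)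
    (a : PfaffianRing n (r + 1) k →ₐ[k] B) {e : Fin (2 * r) ↪o Fin n}
    (hu : IsUnit (pfaffian ((pfaffianMatrix a).submatrix e e))) :
    ∃ x : HomRing r n k →ₐ[k] B, x.comp (coquotient r n k (r + 1) h) = a := by
  obtain ⟨X, hX⟩ := (isAlternating_pfaffianMatrix a).exists_conj_formMatrix_eq_of_pfaffian hu
    (pfaffian_pfaffianMatrix_eq_zero a)
  obtain ⟨x, rfl⟩ := exists_homMatrix_eq (k := k) X
  exact ⟨x, pfaffianMatrix_injective ((pfaffianMatrix_comp_coquotient h x).trans hX)⟩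

/-- Two points of `Hom(V, E)` with the same nondegenerate image in the quotient differ by a unique
point of the symplectic group. -/
theorem existsUnique_symplecticMatrix_mul (h : r < s) {x y : HomRing r n k →ₐ[k] B}
    (hxy : x.comp (coquotient r n k s h) = y.comp (coquotient r n k s h))
    {e : Fin (2 * r) ↪o Fin n}
    (hu : IsUnit (pfaffian ((pfaffianMatrix (y.comp (coquotient r n k s h))).submatrix e e))) :
    ∃! g : SymplecticRing r k →ₐ[k] B, symplecticMatrix g * homMatrix y = homMatrix x := by
  have hd := ((isAlternating_pfaffianMatrix (y.comp (coquotient r n k s h))).submatrix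
    e).isUnit_det_iff.2 hu
  rw [pfaffianMatrix_comp_coquotient] at hd
  have hX := congrArg pfaffianMatrix hxy
  rw [pfaffianMatrix_comp_coquotient, pfaffianMatrix_comp_coquotient] at hX
  obtain ⟨g, ⟨hg1, hg2⟩, hg⟩ := existsUnique_symplectic hX hd
  obtain ⟨γ, rfl⟩ := exists_symplecticMatrix_eq (k := k) hg1
  exact ⟨γ, hg2, fun γ' h' => symplecticMatrix_injective (hg _ ⟨symplecticMatrix_rel γ', h'⟩)⟩

theorem homMatrix_comp {C : Type*} [CommRing C] [Algebra k C] (f : B →ₐ[k] C)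
    (x : HomRing r n k →ₐ[k] B) : homMatrix (f.comp x) = (homMatrix x).map f := rfl

theorem symplecticMatrix_comp {C : Type*} [CommRing C] [Algebra k C] (f : B →ₐ[k] C)
    (g : SymplecticRing r k →ₐ[k] B) :
    symplecticMatrix (f.comp g) = (symplecticMatrix g).map f := rfl

end points

/-! ### Flatness and surjectivity on local rings -/

section flat

open scoped TensorProduct
open Algebra.TensorProduct (includeLeft includeRight)

variable {r n s : ℕ} {k : Type u} [Field k]

/-- A section `x₀` trivializes the torsor. The orbit map `g ↦ g x₀` gives `α`, and the symplectic
matrix carrying `x₀` to the tautological point gives `γ`. Only `γ ∘ α = id` is needed: it makes the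
base change a retract of `R ⊗[k] S`, which is flat over `R` because `k` is a field. -/
theorem flat_tensorProduct_of_section (h : r < s) [Algebra (PfaffianRing n s k) (HomRing r n k)]
    [IsScalarTower k (PfaffianRing n s k) (HomRing r n k)]
    (hH : IsScalarTower.toAlgHom k (PfaffianRing n s k) (HomRing r n k) = coquotient r n k s h)
    {R : Type*} [CommRing R] [Algebra k R] [Algebra (PfaffianRing n s k) R]
    [IsScalarTower k (PfaffianRing n s k) R] (x₀ : HomRing r n k →ₐ[k] R)
    (hx₀ : x₀.comp (coquotient r n k s h) = IsScalarTower.toAlgHom k (PfaffianRing n s k) R)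
    {e : Fin (2 * r) ↪o Fin n}
    (hu : IsUnit (pfaffian ((pfaffianMatrix
      (IsScalarTower.toAlgHom k (PfaffianRing n s k) R)).submatrix e e))) :
    Module.Flat R (R ⊗[PfaffianRing n s k] HomRing r n k) := by
  let P := PfaffianRing n s k
  let H := HomRing r n k
  let S := SymplecticRing r k
  let iR : R →ₐ[k] R ⊗[P] H := (includeLeft : R →ₐ[P] R ⊗[P] H).restrictScalars k
  let iH : H →ₐ[k] R ⊗[P] H := (includeRight : H →ₐ[P] R ⊗[P] H).restrictScalars k
  have hcomp : iH.comp (coquotient r n k s h) =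
      (iR.comp x₀).comp (coquotient r n k s h) := by
    rw [AlgHom.comp_assoc, hx₀, ← hH]
    ext1 p
    exact (includeRight : H →ₐ[P] R ⊗[P] H).commutes p |>.trans
      ((includeLeft : R →ₐ[P] R ⊗[P] H).commutes p).symm
  -- The tautological point `iH` and the constant point `x₀` have the same image in the quotient, so
  -- a symplectic `g` over `R ⊗[P] H` takes `x₀` to `iH`.
  obtain ⟨g, hg, -⟩ := existsUnique_symplecticMatrix_mul h hcomp (e := e) (by
    rw [pfaffian_pfaffianMatrix] at hu ⊢
    rw [AlgHom.comp_assoc, hx₀]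
    exact hu.map iR)
  let jR : R →ₐ[k] R ⊗[k] S := includeLeft
  let jS : S →ₐ[k] R ⊗[k] S := includeRight
  obtain ⟨b, hb⟩ := exists_homMatrix_eq (k := k) (symplecticMatrix jS * homMatrix (jR.comp x₀))
  -- Invariance of the form: the whole orbit of `x₀` lies over the same point as `x₀`, which makes
  -- `b` linear over `P`.
  have hb' : b.comp (coquotient r n k s h) =
      jR.comp (IsScalarTower.toAlgHom k (PfaffianRing n s k) R) := by
    rw [← hx₀, ← AlgHom.comp_assoc]
    apply pfaffianMatrix_injective
    rw [pfaffianMatrix_comp_coquotient, pfaffianMatrix_comp_coquotient, hb]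
    conv_rhs => rw [← symplecticMatrix_rel jS]
    simp only [Matrix.transpose_mul, Matrix.mul_assoc]
  let b' : H →ₐ[P] R ⊗[k] S := { b with
    commutes' := fun p => by
      have h1 := DFunLike.congr_fun hb' p
      rw [← hH] at h1
      exact h1.trans (Algebra.TensorProduct.algebraMap_apply p).symm }
  let α : R ⊗[P] H →ₐ[R] R ⊗[k] S :=
    Algebra.TensorProduct.lift (Algebra.ofId R _) b' fun _ _ => Commute.all _ _
  let γ : R ⊗[k] S →ₐ[R] R ⊗[P] H :=
    Algebra.TensorProduct.lift (Algebra.ofId R _) g fun _ _ => Commute.all _ _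
  have hγα : γ.comp α = AlgHom.id R _ := by
    refine Algebra.TensorProduct.ext (Subsingleton.elim _ _) ?_
    have h1 : ((γ.restrictScalars k).comp b) = iH := by
      apply homMatrix_injective
      rw [homMatrix_comp, hb, Matrix.map_mul, ← symplecticMatrix_comp, ← homMatrix_comp, ← hg]
      have h2 : (γ.restrictScalars k).comp jS = g := by
        ext1 z
        exact (Algebra.TensorProduct.lift_tmul _ _ (fun _ _ => Commute.all _ _) _ _).trans
          (by rw [map_one, one_mul])
      have h3 : (γ.restrictScalars k).comp (jR.comp x₀) = iR.comp x₀ := by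
        ext1 z
        refine (Algebra.TensorProduct.lift_tmul _ _ (fun _ _ => Commute.all _ _) _ _).trans ?_
        rw [map_one, mul_one]
        rfl
      rw [h2, h3]
    ext1 z
    refine Eq.trans ?_ (DFunLike.congr_fun h1 z)
    refine congrArg γ
      ((Algebra.TensorProduct.lift_tmul _ _ (fun _ _ => Commute.all _ _) _ _).trans ?_)
    rw [map_one, one_mul]
    rfl
  exact Module.Flat.of_retract α.toLinearMap γ.toLinearMap
    (congrArg AlgHom.toLinearMap hγα)

/-- The base change of `H` to the local ring at `p` is `H` localized at the image of the complement
of `p`, and the local ring at `q` is a further localization of it; flatness composes. -/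
theorem flat_localRingHom_of_flat_tensorProduct {P H : Type*} [CommRing P] [CommRing H]
    [Algebra P H] (q : Ideal H) [q.IsPrime]
    (h : Module.Flat (Localization.AtPrime (q.comap (algebraMap P H)))
      (Localization.AtPrime (q.comap (algebraMap P H)) ⊗[P] H)) :
    (Localization.localRingHom (q.comap (algebraMap P H)) q (algebraMap P H) rfl).Flat := by
  set p := q.comap (algebraMap P H) with hp
  let Pp := Localization.AtPrime p
  let Hp := Localization (Algebra.algebraMapSubmonoid H p.primeCompl)
  let Hq := Localization.AtPrime q
  algebraize_only [Localization.localRingHom p q (algebraMap P H) rfl]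
  have hle : Algebra.algebraMapSubmonoid H p.primeCompl ≤ q.primeCompl := by
    rintro _ ⟨x, hx, rfl⟩
    exact hx
  have : IsScalarTower P Pp Hq :=
    .of_algebraMap_eq fun x ↦ (Localization.localRingHom_to_map _ _ _ rfl x).symm
  let f : Hp →ₐ[H] Hq := IsLocalization.liftAlgHom
    (M := Algebra.algebraMapSubmonoid H p.primeCompl) (f := Algebra.ofId _ _)
    fun x => IsLocalization.map_units (M := q.primeCompl) Hq ⟨x.1, hle x.2⟩
  algebraize [f.toRingHom]
  have : IsScalarTower P Hp Hq := .to₁₃₄ _ H _ _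
  have : IsScalarTower Pp Hp Hq := .of_algebraMap_eq' <| by
    apply IsLocalization.ringHom_ext p.primeCompl
    simp only [RingHom.comp_assoc, ← IsScalarTower.algebraMap_eq]
  have : IsLocalization (Algebra.algebraMapSubmonoid Hp q.primeCompl) Hq :=
    .isLocalization_of_submonoid_le _ _ (Algebra.algebraMapSubmonoid H p.primeCompl) _ hle
  have : Algebra.IsPushout P Pp H Hp :=
    .symm <| Algebra.isPushout_of_isLocalization p.primeCompl _ _ _
  have : Module.Flat Pp Hp := .of_linearEquiv (Algebra.IsPushout.equiv P Pp H Hp).symm.toLinearEquiv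
  have : Module.Flat Hp Hq := IsLocalization.flat Hq (Algebra.algebraMapSubmonoid Hp q.primeCompl)
  exact Module.Flat.trans Pp Hp Hq

/-- The quotient morphism is flat at the points over the locus where a Pfaffian of size `2r` does
not vanish. -/
theorem flat_localRingHom_coquotient (h : r < r + 1) (q : Ideal (HomRing r n k)) [q.IsPrime]
    {e : Fin (2 * r) ↪o Fin n}
    (he : coquotient r n k (r + 1) h (PfaffianRing.mk n (r + 1) k
      (pfaffian ((genericAlternating n k).submatrix e e))) ∉ q) :
    (Localization.localRingHom (q.comap (coquotient r n k (r + 1) h).toRingHom) q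
      (coquotient r n k (r + 1) h).toRingHom rfl).Flat := by
  let _ : Algebra (PfaffianRing n (r + 1) k) (HomRing r n k) :=
    (coquotient r n k (r + 1) h).toRingHom.toAlgebra
  have : IsScalarTower k (PfaffianRing n (r + 1) k) (HomRing r n k) :=
    .of_algebraMap_eq fun x => ((coquotient r n k (r + 1) h).commutes x).symm
  refine flat_localRingHom_of_flat_tensorProduct (P := PfaffianRing n (r + 1) k) q ?_
  set p := q.comap (algebraMap (PfaffianRing n (r + 1) k) (HomRing r n k)) with hp
  have hu : IsUnit (pfaffian ((pfaffianMatrix (IsScalarTower.toAlgHom k (PfaffianRing n (r + 1) k)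
      (Localization.AtPrime p))).submatrix e e)) := by
    rw [pfaffian_pfaffianMatrix]
    exact IsLocalization.map_units (M := p.primeCompl) (Localization.AtPrime p) ⟨_, he⟩
  obtain ⟨x₀, hx₀⟩ := exists_comp_coquotient_eq h _ hu
  exact flat_tensorProduct_of_section h rfl x₀ hx₀ hu

/-- Every point of `Y_{r+1}` at which a Pfaffian of size `2r` does not vanish is in the image of the
quotient morphism. -/
theorem exists_comap_coquotient_eq (h : r < r + 1)
    (p : PrimeSpectrum (PfaffianRing n (r + 1) k)) {e : Fin (2 * r) ↪o Fin n}
    (he : PfaffianRing.mk n (r + 1) k (pfaffian ((genericAlternating n k).submatrix e e)) ∉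
      p.asIdeal) :
    ∃ q, PrimeSpectrum.comap (coquotient r n k (r + 1) h).toRingHom q = p := by
  let R := Localization.AtPrime p.asIdeal
  obtain ⟨x, hx⟩ := exists_comp_coquotient_eq h (e := e)
    (IsScalarTower.toAlgHom k (PfaffianRing n (r + 1) k) R) (by
      rw [pfaffian_pfaffianMatrix]
      exact IsLocalization.map_units (M := p.asIdeal.primeCompl) R ⟨_, he⟩)
  -- The canonical morphism from the spectrum of the local ring at `p` lifts along the quotient
  -- morphism; the image of the closed point under the lift lies over `p`.
  refine ⟨PrimeSpectrum.comap x.toRingHom (IsLocalRing.closedPoint R), ?_⟩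
  rw [← PrimeSpectrum.comap_comp_apply]
  have h1 : x.toRingHom.comp (coquotient r n k (r + 1) h).toRingHom =
      algebraMap _ R := congrArg AlgHom.toRingHom hx
  rw [h1]
  exact PrimeSpectrum.ext Localization.AtPrime.under_maximalIdeal

end flat

/-! ### The rank stratum -/

section stratum

variable {n r : ℕ} {k : Type u} [CommRing k]

theorem rank_residueField_eq_iff (x : PrimeSpectrum (AltRing n k)) :
    ((genericAlternating n k).map
        (algebraMap (AltRing n k) x.asIdeal.ResidueField)).rank = 2 * r ↔
      pfaffianIdeal n (r + 1) k ≤ x.asIdeal ∧ ¬ pfaffianIdeal n r k ≤ x.asIdeal := by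
  rw [((isAlternating_genericAlternating n k).map (algebraMap _ x.asIdeal.ResidueField)).rank_eq_iff]
  have h1 : ∀ {m : ℕ} (e : Fin (2 * m) ↪o Fin n),
      pfaffian (((genericAlternating n k).map
        (algebraMap _ x.asIdeal.ResidueField)).submatrix e e) = 0 ↔
        pfaffian ((genericAlternating n k).submatrix e e) ∈ x.asIdeal := by
    intro m e
    rw [Matrix.submatrix_map, ← map_pfaffian, Ideal.algebraMap_residueField_eq_zero]
  have h2 : ∀ m, pfaffianIdeal n m k ≤ x.asIdeal ↔ ∀ e : Fin (2 * m) ↪o Fin n,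
      pfaffian ((genericAlternating n k).submatrix e e) ∈ x.asIdeal := by
    intro m
    rw [pfaffianIdeal, Ideal.span_le, Set.range_subset_iff]
    rfl
  simp only [h1, h2, ne_eq, not_forall]

end stratum

open CategoryTheory AlgebraicGeometry MonoidalCategory CartesianMonoidalCategory Opposite
open scoped MonObj

/-! ### Functor of points of affine schemes -/

section functorOfPoints

variable {k : Type u} [CommRing k]

/-- The algebra of global functions on a `k`-scheme. -/
abbrev globalFunctions (T : Over (Spec (CommRingCat.of k))) : Type u :=
  ((algΓ (CommRingCat.of k)).obj T).unop

/-- The homomorphism of algebras that corresponds to a morphism to an affine scheme. -/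
def pointHom {T : Over (Spec (CommRingCat.of k))} {A : Type u} [CommRing A] [Algebra k A]
    (f : T ⟶ specOver k A) : A →ₐ[k] globalFunctions T :=
  (((algΓAlgSpecAdjunction (CommRingCat.of k)).homEquiv T (op (CommAlgCat.of k A))).symm f).unop.hom

/-- This lets the matrix statements over rings be applied to points with values in an arbitrary `T`,
affine or not. -/
theorem pointHom_bijective (T : Over (Spec (CommRingCat.of k))) (A : Type u) [CommRing A]
    [Algebra k A] :
    Function.Bijective (pointHom : (T ⟶ specOver k A) → (A →ₐ[k] globalFunctions T)) := by
  constructor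
  · intro f g h
    apply ((algΓAlgSpecAdjunction (CommRingCat.of k)).homEquiv T
      (op (CommAlgCat.of k A))).symm.injective
    apply Quiver.Hom.unop_inj
    ext1
    exact h
  · intro φ
    refine ⟨(algΓAlgSpecAdjunction (CommRingCat.of k)).homEquiv T (op (CommAlgCat.of k A))
      (CommAlgCat.ofHom φ).op, ?_⟩
    rw [pointHom, Equiv.symm_apply_apply]
    rfl

theorem pointHom_comp {T : Over (Spec (CommRingCat.of k))} {A B : Type u} [CommRing A]
    [Algebra k A] [CommRing B] [Algebra k B] (f : T ⟶ specOver k A) (φ : B →ₐ[k] A) :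
    pointHom (f ≫ (algSpec (CommRingCat.of k)).map (CommAlgCat.ofHom φ).op) =
      (pointHom f).comp φ := by
  rw [pointHom, Adjunction.homEquiv_naturality_right_symm]
  rfl

/-- A morphism that lands in the basic open set of `a` factors through the spectrum of
`Localization.Away a`, where `a` is a unit. -/
theorem isUnit_pointHom {T : Over (Spec (CommRingCat.of k))} {A : Type u} [CommRing A]
    [Algebra k A] (f : T ⟶ specOver k A) (a : A)
    (h : Set.range f.left ⊆ (PrimeSpectrum.basicOpen a : Set (PrimeSpectrum A))) :
    IsUnit (pointHom f a) := by
  let j := (algSpec (CommRingCat.of k)).map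
    (CommAlgCat.ofHom (IsScalarTower.toAlgHom k A (Localization.Away a))).op
  have hj : IsOpenImmersion j.left :=
    IsOpenImmersion.of_isLocalization (R := CommRingCat.of A) (S := Localization.Away a) a
  have hr : Set.range f.left ⊆ Set.range j.left := by
    refine h.trans_eq ?_
    exact (PrimeSpectrum.localization_away_comap_range (Localization.Away a) a).symm
  let g : T ⟶ specOver k (Localization.Away a) :=
    Over.homMk (IsOpenImmersion.lift j.left f.left hr) (by
      rw [← Over.w j, IsOpenImmersion.lift_fac_assoc]
      exact Over.w f)
  have hg : g ≫ j = f := by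
    ext1
    exact IsOpenImmersion.lift_fac _ _ _
  rw [← hg, pointHom_comp]
  exact (IsLocalization.Away.algebraMap_isUnit a).map (pointHom g)

variable {r n : ℕ}

open scoped TensorProduct
open Algebra.TensorProduct (includeLeft includeRight)

/-- The homomorphism `z` is the pair `(g, y)` seen as a point of the spectrum of the tensor product.
The last clause evaluates a morphism out of the product, such as the action, through its comorphism.
-/
theorem exists_pointHom_lift {A M : Type u} [CommRing A] [Algebra k A] [CommRing M] [Algebra k M]
    {T : Over (Spec (CommRingCat.of k))} (g : T ⟶ specOver k A) (y : T ⟶ specOver k M) :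
    ∃ z : A ⊗[k] M →ₐ[k] globalFunctions T, z.comp includeLeft = pointHom g ∧
      z.comp includeRight = pointHom y ∧ ∀ {C : Type u} [CommRing C] [Algebra k C]
        (φ : C →ₐ[k] A ⊗[k] M), pointHom (lift g y ≫
          Functor.LaxMonoidal.μ (algSpec (CommRingCat.of k)) (op (CommAlgCat.of k A))
            (op (CommAlgCat.of k M)) ≫ (algSpec (CommRingCat.of k)).map (CommAlgCat.ofHom φ).op) =
          z.comp φ := by
  let F := algSpec (CommRingCat.of k)
  let A' : (CommAlgCat k)ᵒᵖ := op (CommAlgCat.of k A)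
  let M' : (CommAlgCat k)ᵒᵖ := op (CommAlgCat.of k M)
  let z : T ⟶ specOver k (A ⊗[k] M) := lift g y ≫ Functor.LaxMonoidal.μ F A' M'
  refine ⟨pointHom z, ?_, ?_, ?_⟩
  · rw [← pointHom_comp]
    refine congrArg pointHom ?_
    change (lift g y ≫ Functor.LaxMonoidal.μ F A' M') ≫ F.map (fst A' M') = g
    rw [Category.assoc, Functor.Monoidal.μ_fst, lift_fst]
  · rw [← pointHom_comp]
    refine congrArg pointHom ?_
    change (lift g y ≫ Functor.LaxMonoidal.μ F A' M') ≫ F.map (snd A' M') = y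
    rw [Category.assoc, Functor.Monoidal.μ_snd, lift_snd]
  · intro C _ _ φ
    rw [← pointHom_comp]
    exact congrArg pointHom (Category.assoc _ _ _).symm

theorem homMatrix_pointHom_smul {T : Over (Spec (CommRingCat.of k))}
    (g : T ⟶ symplecticGroupScheme r k) (y : T ⟶ homScheme r n k) :
    homMatrix (pointHom (lift g y ≫ γ[symplecticGroupScheme r k, homScheme r n k])) =
      symplecticMatrix (pointHom g) * homMatrix (pointHom y) := by
  obtain ⟨z, hz1, hz2, hz⟩ := exists_pointHom_lift (A := SymplecticRing r k)
    (M := HomRing r n k) g y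
  have h : pointHom (lift g y ≫ γ[symplecticGroupScheme r k, homScheme r n k]) =
      z.comp (coaction r n k) := hz (coaction r n k)
  rw [← hz1, ← hz2]
  refine (congrArg homMatrix h).trans ?_
  rw [homMatrix_comp, homMatrix_comp, symplecticMatrix_comp, ← Matrix.map_mul]
  exact congrArg (fun X => X.map z) (map_coaction r n k)

end functorOfPoints

/-! ### Morphisms studied locally on the base -/

section localIso

/-- Being an isomorphism is local on the target. Over `U i`, lifting the identity gives a right
inverse, and uniqueness of the lift of the restriction of `f` makes it a left inverse. -/
theorem isIso_of_existsUnique_lift {X Y : Scheme.{u}} (f : X ⟶ Y) {I : Type*} (U : I → Y.Opens)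
    (hU : iSup U = ⊤)
    (h : ∀ i (T : Scheme.{u}) (t : T ⟶ (U i).toScheme), ∃! s : T ⟶ X, s ≫ f = t ≫ (U i).ι) :
    IsIso f := by
  change MorphismProperty.isomorphisms Scheme f
  rw [IsZariskiLocalAtTarget.iff_of_iSup_eq_top (P := MorphismProperty.isomorphisms Scheme) U hU]
  intro i
  obtain ⟨s, hs, -⟩ := h i _ (𝟙 _)
  rw [Category.id_comp] at hs
  let s' : (U i).toScheme ⟶ (f ⁻¹ᵁ U i).toScheme := (isPullback_morphismRestrict f (U i)).lift
    (𝟙 _) s (by rw [hs, Category.id_comp])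
  have h1 : s' ≫ (f ⁻¹ᵁ U i).ι = s := (isPullback_morphismRestrict f (U i)).lift_snd _ _ _
  have h2 : s' ≫ (f ∣_ U i) = 𝟙 _ := (isPullback_morphismRestrict f (U i)).lift_fst _ _ _
  refine ⟨s', ?_, h2⟩
  rw [← cancel_mono (f ⁻¹ᵁ U i).ι, Category.assoc, h1, Category.id_comp]
  refine (h i _ (f ∣_ U i)).unique ?_ ?_
  · rw [Category.assoc, hs]
  · exact (morphismRestrict_ι f (U i)).symm

/-- Flatness is tested on stalks, and restricting to an open set does not change them. -/
theorem flat_morphismRestrict_SpecMap {R S : CommRingCat.{u}} (φ : R ⟶ S) (U : (Spec R).Opens)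
    (h : ∀ q : PrimeSpectrum S, PrimeSpectrum.comap φ.hom q ∈ U →
      (Localization.localRingHom (PrimeSpectrum.comap φ.hom q).asIdeal q.asIdeal φ.hom rfl).Flat) :
    Flat (Spec.map φ ∣_ U) := by
  refine Flat.of_stalkMap _ fun x => ?_
  rw [RingHom.Flat.respectsIso.arrow_mk_iso_iff (morphismRestrictStalkMap _ _ x),
    RingHom.Flat.respectsIso.arrow_mk_iso_iff (Scheme.arrowStalkMapSpecIso φ x.1)]
  exact h x.1 x.2

theorem restrictHom_ι {S : Scheme.{u}} {X Y : Over S} (f : X ⟶ Y) (U : Y.left.Opens) :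
    restrictHom f U ≫ openSubschemeι Y U = openSubschemeι X (f.left ⁻¹ᵁ U) ≫ f := by
  ext1
  exact morphismRestrict_ι f.left U

theorem restrictSMul_restrictHom {S : Scheme.{u}} {G X Y : Over S} [MonObj G] [ModObj G X]
    (f : X ⟶ Y) (hf : γ[G, X] ≫ f = snd G X ≫ f) (U : Y.left.Opens) :
    restrictSMul f hf U ≫ restrictHom f U =
      snd G (openSubscheme X (f.left ⁻¹ᵁ U)) ≫ restrictHom f U := by
  rw [← cancel_mono (openSubschemeι Y U), Category.assoc, Category.assoc, restrictHom_ι,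
    ← Category.assoc, restrictSMul_ι, Category.assoc, hf, whiskerLeft_snd_assoc]

/-- If, locally on the base, two points with the same image differ by a unique point of `G`, then
`G × X → X ×_Y X` is an isomorphism. -/
theorem isIso_lift_of_existsUnique {S : Scheme.{u}} {G X Y : Over S} (a : G ⊗ X ⟶ X) (f : X ⟶ Y)
    (inv : a ≫ f = snd G X ≫ f) {I : Type*} (V : I → Y.left.Opens) (hV : iSup V = ⊤)
    (h : ∀ i (T : Over S) (x y : T ⟶ X), x ≫ f = y ≫ f → Set.range (y ≫ f).left ⊆ V i →
      ∃! g : T ⟶ G, lift g y ≫ a = x) :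
    IsIso (Limits.pullback.lift (f := f.left) (g := f.left) a.left (snd G X).left
      (congrArg CommaMorphism.left inv)) := by
  let p₁ := Limits.pullback.fst f.left f.left
  let p₂ := Limits.pullback.snd f.left f.left
  have hp : p₁ ≫ f.left = p₂ ≫ f.left := Limits.pullback.condition
  have hp' : p₁ ≫ X.hom = p₂ ≫ X.hom := by
    rw [← Over.w f, ← Category.assoc, hp, Category.assoc]
  set Φ := Limits.pullback.lift (f := f.left) (g := f.left) a.left (snd G X).left
    (congrArg CommaMorphism.left inv) with hΦ
  have hΦ₁ : Φ ≫ p₁ = a.left := Limits.pullback.lift_fst _ _ _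
  have hΦ₂ : Φ ≫ p₂ = (snd G X).left := Limits.pullback.lift_snd _ _ _
  refine isIso_of_existsUnique_lift Φ (fun i => (p₂ ≫ f.left) ⁻¹ᵁ V i) ?_ ?_
  · rw [← Scheme.Hom.preimage_iSup, hV]
    rfl
  intro i T t
  let W := (p₂ ≫ f.left) ⁻¹ᵁ V i
  -- `T` becomes an `S`-scheme through the second projection; by `hp'` the first gives the same
  -- structure, so both are `S`-points of `X`.
  let T' : Over S := Over.mk ((t ≫ W.ι ≫ p₂) ≫ X.hom)
  let y : T' ⟶ X := Over.homMk (t ≫ W.ι ≫ p₂) rfl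
  let x : T' ⟶ X := Over.homMk (t ≫ W.ι ≫ p₁) (by
    change _ = (t ≫ W.ι ≫ p₂) ≫ X.hom
    simp only [Category.assoc, hp'])
  have hxy : x ≫ f = y ≫ f := by
    ext1
    change (t ≫ W.ι ≫ p₁) ≫ f.left = (t ≫ W.ι ≫ p₂) ≫ f.left
    simp only [Category.assoc, hp]
  obtain ⟨g, hg, hg'⟩ := h i T' x y hxy (by
    rintro _ ⟨z, rfl⟩
    exact (t z).2)
  refine ⟨(lift g y).left, ?_, ?_⟩
  · apply Limits.pullback.hom_ext
    · rw [Category.assoc, Category.assoc]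
      refine (congrArg (fun b => (lift g y).left ≫ b) hΦ₁).trans ?_
      exact congrArg CommaMorphism.left hg
    · rw [Category.assoc, Category.assoc]
      refine (congrArg (fun b => (lift g y).left ≫ b) hΦ₂).trans ?_
      exact congrArg CommaMorphism.left (lift_snd g y)
  · intro s hs
    have hs₁ : s ≫ a.left = x.left := by
      rw [← hΦ₁, ← Category.assoc, hs, Category.assoc]
      rfl
    have hs₂ : s ≫ (snd G X).left = y.left := by
      rw [← hΦ₂, ← Category.assoc, hs, Category.assoc]
      rfl
    let s' : T' ⟶ G ⊗ X := Over.homMk s (by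
      rw [← Over.w (snd G X), ← Category.assoc, hs₂]
      rfl)
    have h1 : s' ≫ a = x := by
      ext1
      exact hs₁
    have h2 : s' ≫ snd G X = y := by
      ext1
      exact hs₂
    -- The second component of any lift is forced to be `y`, so uniqueness reduces to its component
    -- in `G`.
    have h3 : lift (s' ≫ fst G X) y = s' := by
      rw [← h2]
      exact hom_ext _ _ (lift_fst _ _) (lift_snd _ _)
    have h4 : s' ≫ fst G X = g := hg' _ ((congrArg (· ≫ a) h3).trans h1)
    rw [← h4, h3]
    rfl

end localIso

/-! ### The restricted quotient morphism -/

section main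

variable (r n : ℕ) (k : Type u) [Field k]

theorem mem_pfaffianOpen_iff (s : ℕ) (x : PrimeSpectrum (PfaffianRing n s k)) :
    x ∈ pfaffianOpen r n s k ↔
      ¬ pfaffianIdeal n r k ≤ x.asIdeal.comap (PfaffianRing.mk n s k).toRingHom := by
  change ¬ ((pfaffianIdeal n r k).map (PfaffianRing.mk n s k) : Set (PfaffianRing n s k)) ⊆
    x.asIdeal ↔ _
  rw [SetLike.coe_subset_coe, Ideal.map_le_iff_le_comap]
  rfl

theorem exists_pfaffian_notMem {s : ℕ} {x : PrimeSpectrum (PfaffianRing n s k)}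
    (hx : x ∈ pfaffianOpen r n s k) : ∃ e : Fin (2 * r) ↪o Fin n,
      PfaffianRing.mk n s k (pfaffian ((genericAlternating n k).submatrix e e)) ∉ x.asIdeal := by
  rw [mem_pfaffianOpen_iff, pfaffianIdeal, Ideal.span_le, Set.range_subset_iff] at hx
  simpa using hx

theorem image_pfaffianOpen :
    (pfaffianInclusion n (r + 1) k).left '' (pfaffianOpen r n (r + 1) k) =
      exactRankLocus n k (2 * r) := by
  ext x
  have hx : x ∈ exactRankLocus n k (2 * r) ↔
      pfaffianIdeal n (r + 1) k ≤ x.asIdeal ∧ ¬ pfaffianIdeal n r k ≤ x.asIdeal :=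
    rank_residueField_eq_iff x
  rw [hx]
  have hker : RingHom.ker (PfaffianRing.mk n (r + 1) k).toRingHom = pfaffianIdeal n (r + 1) k :=
    Ideal.mk_ker
  have hsurj : Function.Surjective (PfaffianRing.mk n (r + 1) k).toRingHom :=
    Ideal.Quotient.mk_surjective
  constructor
  · rintro ⟨y, hy, rfl⟩
    refine ⟨?_, (mem_pfaffianOpen_iff r n k (r + 1) y).1 hy⟩
    rw [← hker]
    exact Ideal.ker_le_comap (K := y.asIdeal) (PfaffianRing.mk n (r + 1) k).toRingHom
  · rintro ⟨h1, h2⟩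
    rw [← hker] at h1
    obtain ⟨y, hy⟩ : x ∈ Set.range (PrimeSpectrum.comap (PfaffianRing.mk n (r + 1) k).toRingHom) := by
      rw [range_comap_of_surjective _ _ hsurj]
      exact h1
    refine ⟨y, ?_, hy⟩
    rw [← hy] at h2
    exact (mem_pfaffianOpen_iff r n k (r + 1) y).2 h2

theorem flat_restrictedQuotient (h : r < r + 1) :
    Flat (restrictedQuotient r n (r + 1) h k).left := by
  refine flat_morphismRestrict_SpecMap
    (CommRingCat.ofHom (coquotient r n k (r + 1) h).toRingHom) (pfaffianOpen r n (r + 1) k) ?_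
  intro q hq
  obtain ⟨e, he⟩ := exists_pfaffian_notMem r n k hq
  exact flat_localRingHom_coquotient h q.asIdeal he

theorem surjective_restrictedQuotient (h : r < r + 1) :
    Surjective (restrictedQuotient r n (r + 1) h k).left := by
  refine ⟨fun y => ?_⟩
  obtain ⟨e, he⟩ := exists_pfaffian_notMem r n k y.2
  obtain ⟨q, hq⟩ := exists_comap_coquotient_eq h y.1 he
  have hx : (quotientMorphism r n (r + 1) k h).left q = y.1 := hq
  refine ⟨⟨q, ?_⟩, ?_⟩
  · change (quotientMorphism r n (r + 1) k h).left q ∈ pfaffianOpen r n (r + 1) k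
    rw [hx]
    exact y.2
  · refine Subtype.ext ?_
    exact (morphismRestrict_base_coe (quotientMorphism r n (r + 1) k h).left _ _).trans hx

/-- Simple transitivity on `T`-points: `existsUnique_symplecticMatrix_mul` over the ring of global
functions of `T`, where `he` makes the Pfaffian a unit. -/
theorem existsUnique_smul_eq {s : ℕ} (h : r < s) {T : Over (Spec (CommRingCat.of k))}
    {x y : T ⟶ homScheme r n k}
    (hxy : x ≫ quotientMorphism r n s k h = y ≫ quotientMorphism r n s k h)
    {e : Fin (2 * r) ↪o Fin n}
    (he : Set.range (y ≫ quotientMorphism r n s k h).left ⊆ (PrimeSpectrum.basicOpen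
      (PfaffianRing.mk n s k (pfaffian ((genericAlternating n k).submatrix e e))) :
        Set (PrimeSpectrum (PfaffianRing n s k)))) :
    ∃! g : T ⟶ symplecticGroupScheme r k,
      lift g y ≫ γ[symplecticGroupScheme r k, homScheme r n k] = x := by
  have hcomp : ∀ z : T ⟶ homScheme r n k, pointHom (A := PfaffianRing n s k)
      (z ≫ quotientMorphism r n s k h) = (pointHom z).comp (coquotient r n k s h) :=
    fun z => pointHom_comp z (coquotient r n k s h)
  have hiff : ∀ g : T ⟶ symplecticGroupScheme r k,
      lift g y ≫ γ[symplecticGroupScheme r k, homScheme r n k] = x ↔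
        symplecticMatrix (pointHom g) * homMatrix (pointHom y) = homMatrix (pointHom x) := by
    intro g
    rw [← homMatrix_pointHom_smul]
    exact ((pointHom_bijective T (HomRing r n k)).1.eq_iff.symm).trans
      (homMatrix_injective.eq_iff.symm)
  obtain ⟨g, hg, hg'⟩ := existsUnique_symplecticMatrix_mul h (e := e)
    (x := pointHom x) (y := pointHom y)
    ((hcomp x).symm.trans ((congrArg pointHom hxy).trans (hcomp y)))
    (by
      rw [← hcomp, pfaffian_pfaffianMatrix]
      exact isUnit_pointHom _ _ he)
  obtain ⟨g, rfl⟩ := (pointHom_bijective T (SymplecticRing r k)).2 g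
  exact ⟨g, (hiff g).2 hg, fun g₁ h₁ =>
    (pointHom_bijective T (SymplecticRing r k)).1 (hg' _ ((hiff g₁).1 h₁))⟩

theorem isPrincipalBundle_restrictedQuotient (h : r < r + 1) :
    IsPrincipalBundle (symplecticGroupScheme r k) (restrictedQuotient r n (r + 1) h k) where
  flat := flat_restrictedQuotient r n k h
  surjective := surjective_restrictedQuotient r n k h
  invariant := restrictSMul_restrictHom (quotientMorphism r n (r + 1) k h)
    (smul_quotientMorphism r n (r + 1) k h) (pfaffianOpen r n (r + 1) k)
  isIso := by
    let π := quotientMorphism r n (r + 1) k h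
    let hπ := smul_quotientMorphism r n (r + 1) k h
    let U := pfaffianOpen r n (r + 1) k
    let pf (e : Fin (2 * r) ↪o Fin n) : PfaffianRing n (r + 1) k :=
      PfaffianRing.mk n (r + 1) k (pfaffian ((genericAlternating n k).submatrix e e))
    -- These open sets cover `U`, whose complement is where all Pfaffians of size `2r` vanish.
    let V (e : Fin (2 * r) ↪o Fin n) : (pfaffianScheme n (r + 1) k).left.Opens :=
      PrimeSpectrum.basicOpen (pf e)
    refine isIso_lift_of_existsUnique (restrictSMul π hπ U) (restrictHom π U)
      (restrictSMul_restrictHom π hπ U) (fun e => U.ι ⁻¹ᵁ V e) ?_ ?_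
    · rw [eq_top_iff]
      intro z _
      obtain ⟨e, he⟩ := exists_pfaffian_notMem r n k z.2
      exact TopologicalSpace.Opens.mem_iSup.2 ⟨e, he⟩
    · intro e T x y hxy hy
      let j := openSubschemeι (homScheme r n k) (π.left ⁻¹ᵁ U)
      have hj : ∀ z : T ⟶ openSubscheme (homScheme r n k) (π.left ⁻¹ᵁ U),
          (z ≫ j) ≫ π = (z ≫ restrictHom π U) ≫ openSubschemeι _ U := fun z => by
        rw [Category.assoc, Category.assoc, restrictHom_ι]
      -- The inclusion of the preimage of `U` is a monomorphism, so the equation for `g` may be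
      -- solved in all of `M`.
      have hiff : ∀ g : T ⟶ symplecticGroupScheme r k, lift g y ≫ restrictSMul π hπ U = x ↔
          lift g (y ≫ j) ≫ γ[symplecticGroupScheme r k, homScheme r n k] = x ≫ j := by
        intro g
        rw [← cancel_mono j, Category.assoc, restrictSMul_ι, ← Category.assoc, lift_whiskerLeft]
      simp only [hiff]
      refine existsUnique_smul_eq r n k h (e := e) ?_ ?_
      · rw [hj, hj, hxy]
      · rw [hj]
        rintro _ ⟨z, rfl⟩
        exact hy ⟨z, rfl⟩

end main

end SymplecticInvariants
end

theorem mainTheorem4 (k : Type*) [Field k] [IsAlgClosed k] (t n : ℕ) (ht : 2 ≤ t)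
    (hn : 2 * t ≤ n) :
    (pfaffianInclusion n t k).left '' (pfaffianOpen (t - 1) n t k) =
        exactRankLocus n k (2 * (t - 1)) ∧
      IsPrincipalBundle (symplecticGroupScheme (t - 1) k)
        (restrictedQuotient (t - 1) n t (Nat.sub_one_lt_of_lt ht) k) := by
  -- With `t = r + 1` the truncated `t - 1` is `r`, and the relevant Pfaffians have sizes `2r + 2`
  -- and `2r`.
  obtain ⟨r, rfl⟩ : ∃ r, t = r + 1 := ⟨t - 1, by omega⟩
  exact ⟨image_pfaffianOpen r n k, isPrincipalBundle_restrictedQuotient r n k r.lt_succ_self⟩
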